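/- Let $p,q,m,s$ be integers with $p>0$ and $mp+sq=1$ (so $p,q$ are coprime). Let $U=\{(w,z)\in\mathbb C\times\mathbb R/2\pi\mathbb Z : |w|<1\}$ be the open solid torus with core $\ell=\{w=0\}$, cylindrical coordinates $w=re^{i\theta}$, and the orientation $dx\wedge dy\wedge dz$, where $w=x+iy$. Let $L(p,q)$ be the oriented smooth three-manifold obtained by gluing two copies of $U$, with inclusions (toroidal charts) $\psi_0,\psi_1:U\to L(p,q)$, along $U\setminus\ell$ by $$\psi_0^{-1}\circ\psi_1(r,\theta,z)=(1-r,\,-q\theta+mz,\,p\theta+sz),\qquad 0<r<1 .$$ A smooth one-form $\alpha$ on $L(p,q)$ is a positive contact form if $\alpha\wedge d\alpha>0$ everywhere, and it is associated with the triple $(a,\tau_0,\phi_0)$ if on $U\setminus\ell$ $$\psi_0^*\alpha=\Big(\frac{\tau_0}{2\pi}-\phi_0\,a(r)\Big)dz+a(r)\,d\theta .$$ **Theorem.** Let $\tau_0>0$, $\phi_0\in\mathbb R$, and let $a,b:[0,1]\to\mathbb R$ be smooth. Let $\alpha,\beta$ be positive contact forms on $L(p,q)$ associated with the triples $(a,\tau_0,\phi_0)$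 and $(b,\tau_0,\phi_0)$, respectively. Then there is a diffeomorphism $\Psi:L(p,q)\to L(p,q)$ with $\Psi^*\beta=\alpha$. Moreover, $\Psi$ can be chosen to be a radial reparametrization in both charts: there is a strictly increasing bijection $\rho:[0,1]\to[0,1]$ with $b\circ\rho=a$ such that, for all $0\le r<1$ and all $\theta,z$, $$\Psi(\psi_0(re^{i\theta},z))=\psi_0(\rho(r)e^{i\theta},z),\qquad \Psi(\psi_1(re^{i\theta},z))=\psi_1\big((1-\rho(1-r))e^{i\theta},z\big).$$ -/

import Mathlib

open Set Topology
open scoped Manifold ContDiff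

noncomputable section

/-- The interior `U = {(w, z) : ‖w‖ < 1}` of the solid torus `D² × S¹`, where `S¹ = ℝ / 2πℤ`. -/
abbrev SolidTorus : Type := Metric.ball (0 : ℂ) 1 × Real.Angle

namespace SolidTorus

/-- The inclusion of the open solid torus in `ℂ × S¹`. -/
def val (u : SolidTorus) : ℂ × Real.Angle := ((u.1 : ℂ), u.2)

theorem isOpenEmbedding_val : IsOpenEmbedding val :=
  (Metric.isOpen_ball.isOpenEmbedding_subtypeVal).prodMap IsOpenEmbedding.id

theorem val_injective : Function.Injective val := isOpenEmbedding_val.injective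

theorem range_val : range val = {x | ‖x.1‖ < 1} := by
  ext x
  constructor
  · rintro ⟨u, rfl⟩
    exact mem_ball_zero_iff.1 u.1.2
  · intro hx
    exact ⟨(⟨x.1, by simpa using hx⟩, x.2), rfl⟩

end SolidTorus

/-- The change of coordinates `(r, θ, z) ↦ (1 - r, -qθ + mz, pθ + sz)` in the cylindrical
coordinates `(r, θ, z) ↦ (r e^{iθ}, z)`; it is meaningful for `0 < r < 1`. -/
def lensTransition (p q m s : ℤ) (x : ℂ × Real.Angle) : ℂ × Real.Angle :=
  (((1 - ‖x.1‖ : ℝ) : ℂ) *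
      (Real.Angle.toCircle ((-q) • (Complex.arg x.1 : Real.Angle) + m • x.2) : ℂ),
    p • (Complex.arg x.1 : Real.Angle) + s • x.2)

section transition

variable {p q m s : ℤ}

theorem norm_lensTransition {x : ℂ × Real.Angle} (hx : ‖x.1‖ < 1) :
    ‖(lensTransition p q m s x).1‖ = 1 - ‖x.1‖ := by
  simp only [lensTransition, norm_mul, Circle.norm_coe, mul_one, Complex.norm_real]
  exact abs_of_pos (by linarith)

theorem lensTransition_left_inv (h : m * p + s * q = 1) {x : ℂ × Real.Angle}
    (hx : ‖x.1‖ < 1) :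
    lensTransition p s m q (lensTransition p q m s x) = x := by
  have hn := norm_lensTransition (p := p) (q := q) (m := m) (s := s) hx
  have harg : (Complex.arg (lensTransition p q m s x).1 : Real.Angle) =
      (-q) • (Complex.arg x.1 : Real.Angle) + m • x.2 := by
    simp only [lensTransition]
    rw [Complex.arg_real_mul _ (by linarith : (0 : ℝ) < 1 - ‖x.1‖), Real.Angle.arg_toCircle]
  have h2 : (lensTransition p q m s x).2 = p • (Complex.arg x.1 : Real.Angle) + s • x.2 := rfl
  have e1 : (-s) • ((-q) • (Complex.arg x.1 : Real.Angle) + m • x.2) +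
      m • (p • (Complex.arg x.1 : Real.Angle) + s • x.2) = (Complex.arg x.1 : Real.Angle) := by
    calc _ = (m * p + s * q) • (Complex.arg x.1 : Real.Angle) := by module
      _ = _ := by rw [h, one_zsmul]
  have e2 : p • ((-q) • (Complex.arg x.1 : Real.Angle) + m • x.2) +
      q • (p • (Complex.arg x.1 : Real.Angle) + s • x.2) = x.2 := by
    calc _ = (m * p + s * q) • x.2 := by module
      _ = _ := by rw [h, one_zsmul]
  ext1
  · conv_lhs => rw [lensTransition]
    simp only [hn, harg, h2, e1]
    rw [Real.Angle.toCircle_coe, Circle.coe_exp]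
    simp [Complex.norm_mul_exp_arg_mul_I]
  · conv_lhs => rw [lensTransition]
    simp only [harg, h2, e2]

theorem lensTransition_right_inv (h : m * p + s * q = 1) {x : ℂ × Real.Angle}
    (hx : ‖x.1‖ < 1) :
    lensTransition p q m s (lensTransition p s m q x) = x :=
  lensTransition_left_inv (by rw [← h]; ring) hx

theorem continuousOn_lensTransition :
    ContinuousOn (lensTransition p q m s) {x | x.1 ≠ 0} := by
  have harg : ContinuousOn (fun x : ℂ × Real.Angle => (Complex.arg x.1 : Real.Angle))
      {x | x.1 ≠ 0} := fun x hx =>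
    ((Complex.continuousAt_arg_coe_angle hx).comp continuousAt_fst).continuousWithinAt
  have hc : Continuous (fun θ : Real.Angle => (Real.Angle.toCircle θ : ℂ)) := by
    simp only [Real.Angle.coe_toCircle]
    exact (Complex.continuous_ofReal.comp Real.Angle.continuous_cos).add
      ((Complex.continuous_ofReal.comp Real.Angle.continuous_sin).mul continuous_const)
  have hcirc := hc.comp_continuousOn ((harg.zsmul (-q)).add (continuousOn_snd.zsmul m))
  refine ContinuousOn.prodMk ?_ ((harg.zsmul p).add (continuousOn_snd.zsmul s))
  exact ContinuousOn.mul (by fun_prop) hcirc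

end transition

/-- The gluing relation on two copies of the open solid torus: a point `v` of the second copy,
off the core circle `ℓ`, is identified with the point `lensTransition p q m s v` of the first. -/
def lensRel (p q m s : ℤ) : SolidTorus ⊕ SolidTorus → SolidTorus ⊕ SolidTorus → Prop
  | .inl u, .inl u' => u = u'
  | .inr v, .inr v' => v = v'
  | .inl u, .inr v => (v.1 : ℂ) ≠ 0 ∧ u.val = lensTransition p q m s v.val
  | .inr v, .inl u => (v.1 : ℂ) ≠ 0 ∧ u.val = lensTransition p q m s v.val

theorem SolidTorus.norm_val_lt (u : SolidTorus) : ‖u.val.1‖ < 1 := by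
  exact mem_ball_zero_iff.1 u.1.2

theorem lensRel_swap {p q m s : ℤ} (h : m * p + s * q = 1) (u v : SolidTorus) :
    ((v.1 : ℂ) ≠ 0 ∧ u.val = lensTransition p q m s v.val) ↔
      ((u.1 : ℂ) ≠ 0 ∧ v.val = lensTransition p s m q u.val) := by
  have key : ∀ {p q m s : ℤ}, m * p + s * q = 1 → ∀ u v : SolidTorus,
      u.val = lensTransition p q m s v.val →
      ((u.1 : ℂ) ≠ 0 ∧ v.val = lensTransition p s m q u.val) := by
    intro p q m s h u v huv
    refine ⟨?_, by rw [huv, lensTransition_left_inv h v.norm_val_lt]⟩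
    have := norm_lensTransition (p := p) (q := q) (m := m) (s := s) v.norm_val_lt
    rw [← huv] at this
    have h1 := v.norm_val_lt
    change (u.val.1) ≠ 0
    rw [← norm_pos_iff, this]
    linarith
  exact ⟨fun hh => key h u v hh.2, fun hh => key (by rw [← h]; ring) v u hh.2⟩

/-- The gluing relation as an equivalence relation. -/
def lensSetoid (p q m s : ℤ) (h : m * p + s * q = 1) : Setoid (SolidTorus ⊕ SolidTorus) where
  r := lensRel p q m s
  iseqv := by
    refine ⟨?_, ?_, ?_⟩
    · rintro (u | u) <;> simp [lensRel]
    · rintro (u | u) (v | v) <;> simp only [lensRel] <;> first | exact Eq.symm | exact id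
    · rintro (u | u) (v | v) (w | w) <;> simp only [lensRel]
      · exact Eq.trans
      · rintro rfl; exact id
      · rintro ⟨-, h1⟩ ⟨-, h2⟩
        exact SolidTorus.val_injective (h1.trans h2.symm)
      · rintro h1 rfl; exact h1
      · rintro h1 rfl; exact h1
      · intro h1 h2
        exact SolidTorus.val_injective
          (((lensRel_swap h v u).1 h1).2.trans ((lensRel_swap h v w).1 h2).2.symm)
      · rintro rfl; exact id
      · exact Eq.trans

/-- The lens space `L(p, q)`, obtained by gluing two open solid tori `U` along `U ∖ ℓ` by
`(r, θ, z) ↦ (1 - r, -qθ + mz, pθ + sz)`, where `mp + sq = 1`. -/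
def LensSpace (p q m s : ℤ) (h : m * p + s * q = 1) : Type :=
  Quotient (lensSetoid p q m s h)

namespace LensSpace

variable {p q m s : ℤ} {h : m * p + s * q = 1}

instance : TopologicalSpace (LensSpace p q m s h) :=
  inferInstanceAs (TopologicalSpace (Quotient (lensSetoid p q m s h)))

/-- The two toroidal charts `ψ₀, ψ₁ : U → L(p, q)`. -/
def psi (i : Fin 2) (u : SolidTorus) : LensSpace p q m s h :=
  if i = 0 then Quotient.mk _ (.inl u) else Quotient.mk _ (.inr u)

theorem psi_zero_eq_psi_one (u v : SolidTorus) :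
    (psi 0 u : LensSpace p q m s h) = psi 1 v ↔
      (v.1 : ℂ) ≠ 0 ∧ u.val = lensTransition p q m s v.val :=
  Quotient.eq (r := lensSetoid p q m s h) (x := Sum.inl u) (y := Sum.inr v)

theorem psi_injective (i : Fin 2) :
    Function.Injective (psi i : SolidTorus → LensSpace p q m s h) := by
  fin_cases i
  · exact fun u v huv =>
      (Quotient.eq (r := lensSetoid p q m s h) (x := Sum.inl u) (y := Sum.inl v)).1 huv
  · exact fun u v huv =>
      (Quotient.eq (r := lensSetoid p q m s h) (x := Sum.inr u) (y := Sum.inr v)).1 huv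

theorem exists_psi (x : LensSpace p q m s h) : ∃ i u, psi i u = x := by
  induction x using Quotient.inductionOn with
  | h y => rcases y with u | u
           · exact ⟨0, u, rfl⟩
           · exact ⟨1, u, rfl⟩

theorem continuous_psi (i : Fin 2) :
    Continuous (psi i : SolidTorus → LensSpace p q m s h) := by
  fin_cases i
  · exact continuous_quotient_mk'.comp continuous_inl
  · exact continuous_quotient_mk'.comp continuous_inr

theorem isOpen_glue {p q m s : ℤ} {O : Set SolidTorus} (hO : IsOpen O) :
    IsOpen {v : SolidTorus | ∃ u ∈ O, (v.1 : ℂ) ≠ 0 ∧ u.val = lensTransition p q m s v.val} := by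
  have h1 : IsOpen {x : ℂ × Real.Angle | x.1 ≠ 0} := isOpen_ne_fun continuous_fst continuous_const
  have h2 := (continuousOn_lensTransition (p := p) (q := q) (m := m) (s := s)).isOpen_inter_preimage
    h1 (SolidTorus.isOpenEmbedding_val.isOpenMap O hO)
  convert h2.preimage SolidTorus.isOpenEmbedding_val.continuous using 1
  ext v
  simp only [mem_ofPred_eq, mem_preimage, mem_inter_iff, mem_image]
  constructor
  · rintro ⟨u, hu, hv, huv⟩
    exact ⟨hv, u, hu, huv⟩
  · rintro ⟨hv, u, hu, huv⟩
    exact ⟨u, hu, hv, huv⟩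

theorem isOpenMap_psi (i : Fin 2) :
    IsOpenMap (psi i : SolidTorus → LensSpace p q m s h) := by
  intro O hO
  have hq : IsOpen (Quotient.mk (lensSetoid p q m s h) ⁻¹' (psi i '' O)) := by
    rw [isOpen_sum_iff]
    fin_cases i
    · constructor
      · convert hO using 1
        exact (psi_injective (h := h) 0).preimage_image O
      · convert isOpen_glue (p := p) (q := q) (m := m) (s := s) hO using 1
        ext v
        change (∃ u ∈ O, (psi 0 u : LensSpace p q m s h) = psi 1 v) ↔ _
        simp only [psi_zero_eq_psi_one, mem_ofPred_eq]
    · constructor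
      · convert isOpen_glue (p := p) (q := s) (m := m) (s := q) hO using 1
        ext v
        change (∃ u ∈ O, (psi 1 u : LensSpace p q m s h) = psi 0 v) ↔ _
        simp only [eq_comm (b := psi 0 v), psi_zero_eq_psi_one, lensRel_swap h, mem_ofPred_eq]
      · convert hO using 1
        exact (psi_injective (h := h) 1).preimage_image O
  exact hq

theorem isOpenEmbedding_psi (i : Fin 2) :
    IsOpenEmbedding (psi i : SolidTorus → LensSpace p q m s h) :=
  .of_continuous_injective_isOpenMap (continuous_psi i) (psi_injective i) (isOpenMap_psi i)

instance : Nonempty SolidTorus := ⟨(⟨0, by simp⟩, 0)⟩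

instance : Fact (0 < 2 * Real.pi) := ⟨Real.two_pi_pos⟩

/-- The local coordinate on `S¹ = ℝ / 2πℤ` with values in `(c, c + 2π)`, as the inverse of the
projection `ℝ → S¹`. -/
def angleChart (c : ℝ) : OpenPartialHomeomorph ℝ Real.Angle :=
  AddCircle.openPartialHomeomorphCoe (2 * Real.pi) c

/-- The coordinates `(w, z)`, with `z ∈ (c, c + 2π)`, on the `i`-th solid torus in `L(p, q)`. -/
def chart (i : Fin 2) (c : ℝ) : OpenPartialHomeomorph (LensSpace p q m s h) (ℂ × ℝ) :=
  ((isOpenEmbedding_psi i).toOpenPartialHomeomorph (psi i)).symm.trans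
    ((SolidTorus.isOpenEmbedding_val.toOpenPartialHomeomorph SolidTorus.val).trans
      ((OpenPartialHomeomorph.refl ℂ).prod (angleChart c).symm))

theorem chart_target (i : Fin 2) (c : ℝ) :
    (chart i c : OpenPartialHomeomorph (LensSpace p q m s h) (ℂ × ℝ)).target =
      {y | ‖y.1‖ < 1 ∧ y.2 ∈ Ioo c (c + 2 * Real.pi)} := by
  ext y
  have hr := SolidTorus.range_val
  have h3 : (angleChart c).source = Ioo c (c + 2 * Real.pi) := rfl
  simp [chart, hr, h3, and_comm]

theorem chart_psi (i : Fin 2) (c : ℝ) (u : SolidTorus) :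
    (chart i c : OpenPartialHomeomorph (LensSpace p q m s h) (ℂ × ℝ)) (psi i u) =
      ((u.1 : ℂ), (angleChart c).symm u.2) := by
  simp only [chart, OpenPartialHomeomorph.trans_apply]
  rw [(isOpenEmbedding_psi i).toOpenPartialHomeomorph_left_inv]
  rfl

theorem chart_source (i : Fin 2) (c : ℝ) :
    (chart i c : OpenPartialHomeomorph (LensSpace p q m s h) (ℂ × ℝ)).source =
      psi i '' {u | u.2 ≠ (c : Real.Angle)} := by
  ext x
  simp only [chart, OpenPartialHomeomorph.trans_source, OpenPartialHomeomorph.symm_source,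
    IsOpenEmbedding.toOpenPartialHomeomorph_target, IsOpenEmbedding.toOpenPartialHomeomorph_source,
    mem_inter_iff, mem_preimage, mem_image, mem_range, mem_ofPred_eq, univ_inter]
  constructor
  · rintro ⟨⟨u, rfl⟩, hu⟩
    rw [(isOpenEmbedding_psi i).toOpenPartialHomeomorph_left_inv] at hu
    exact ⟨u, hu.2, rfl⟩
  · rintro ⟨u, hu, rfl⟩
    refine ⟨⟨u, rfl⟩, ?_⟩
    rw [(isOpenEmbedding_psi i).toOpenPartialHomeomorph_left_inv]
    exact ⟨trivial, hu⟩

theorem chart_symm (i : Fin 2) (c : ℝ) (w : ℂ) (hw : w ∈ Metric.ball (0 : ℂ) 1) (t : ℝ) :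
    (chart i c : OpenPartialHomeomorph (LensSpace p q m s h) (ℂ × ℝ)).symm (w, t) =
      psi i (⟨w, hw⟩, (t : Real.Angle)) := by
  have : (w, (t : Real.Angle)) = SolidTorus.val (⟨w, hw⟩, (t : Real.Angle)) := rfl
  have h2 := SolidTorus.isOpenEmbedding_val.toOpenPartialHomeomorph_left_inv (f := SolidTorus.val)
    (x := (⟨w, hw⟩, (t : Real.Angle)))
  rw [← this] at h2
  exact congrArg (psi i) h2

theorem exists_mem_chart_source (x : LensSpace p q m s h) :
    ∃ i : Fin 2, ∃ c : ℝ, x ∈ (chart i c :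
      OpenPartialHomeomorph (LensSpace p q m s h) (ℂ × ℝ)).source := by
  obtain ⟨i, u, rfl⟩ := exists_psi x
  obtain ⟨c, hc⟩ : ∃ c : ℝ, u.2 ≠ (c : Real.Angle) := by
    by_contra! hcon
    have : ((0 : ℝ) : Real.Angle) = (Real.pi : Real.Angle) := (hcon 0).symm.trans (hcon _)
    exact Real.Angle.pi_ne_zero this.symm
  exact ⟨i, c, by rw [chart_source]; exact ⟨u, hc, rfl⟩⟩

/-- The smooth atlas of `L(p, q)`, with values in `ℂ × ℝ`. -/
instance : ChartedSpace (ℂ × ℝ) (LensSpace p q m s h) where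
  atlas := {e | ∃ (i : Fin 2) (c : ℝ), e = chart i c}
  chartAt x := chart (exists_mem_chart_source x).choose
    (exists_mem_chart_source x).choose_spec.choose
  mem_chart_source x := (exists_mem_chart_source x).choose_spec.choose_spec
  chart_mem_atlas _ := ⟨_, _, rfl⟩

theorem contDiffAt_angleChart (c t : ℝ) (ht : (t : Real.Angle) ≠ c) :
    ContDiffAt ℝ ∞ (fun t : ℝ => (angleChart c).symm (t : Real.Angle)) t := by
  set d : ℝ := (angleChart c).symm (t : Real.Angle) with hd
  have hmem : (t : Real.Angle) ∈ (angleChart c).target := ht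
  have hsrc : d ∈ Ioo c (c + 2 * Real.pi) := (angleChart c).map_target hmem
  have hdt : (d : Real.Angle) = t := (angleChart c).right_inv hmem
  have hcont : ContinuousAt (fun y : ℝ => y - t + d) t := by fun_prop
  have hev : ∀ᶠ y in 𝓝 t, y - t + d ∈ Ioo c (c + 2 * Real.pi) :=
    hcont.eventually_mem (isOpen_Ioo.mem_nhds (by simpa using hsrc))
  refine ContDiffAt.congr_of_eventuallyEq (f := fun y : ℝ => y - t + d) (by fun_prop) ?_
  filter_upwards [hev] with y hy
  have h1 : (y : Real.Angle) = ((y - t + d : ℝ) : Real.Angle) := by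
    rw [Real.Angle.coe_add, Real.Angle.coe_sub, hdt, sub_add_cancel]
  rw [h1]
  exact (angleChart c).left_inv hy

theorem contDiffAt_lensTransition {p q m s : ℤ} (c : ℝ) (y : ℂ × ℝ) (hy : y.1 ≠ 0)
    (hc : (lensTransition p q m s (y.1, (y.2 : Real.Angle))).2 ≠ c) :
    ContDiffAt ℝ ∞ (fun y : ℂ × ℝ =>
      ((lensTransition p q m s (y.1, (y.2 : Real.Angle))).1,
        (angleChart c).symm (lensTransition p q m s (y.1, (y.2 : Real.Angle))).2)) y := by
  -- a smooth local branch of the argument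
  set θ : ℂ × ℝ → ℝ := fun x => (Complex.log (x.1 / y.1)).im + Complex.arg y.1 with hθ
  have hθs : ContDiffAt ℝ ∞ θ y := by
    have h1 : ContDiffAt ℝ ∞ Complex.log (y.1 / y.1) := by
      rw [div_self hy]
      exact (Complex.contDiffAt_log (n := ∞) Complex.one_mem_slitPlane).restrict_scalars ℝ
    have h2 : ContDiffAt ℝ ∞ (fun x : ℂ × ℝ => x.1 / y.1) y := by
      simp only [div_eq_mul_inv]
      fun_prop
    have h3 : ContDiffAt ℝ ∞ (fun x : ℂ × ℝ => Complex.log (x.1 / y.1)) y :=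
      ContDiffAt.comp (g := Complex.log) (f := fun x : ℂ × ℝ => x.1 / y.1) y h1 h2
    exact (Complex.imCLM.contDiff.contDiffAt.comp y h3).add contDiffAt_const
  have hθa : ∀ᶠ x in 𝓝 y, (Complex.arg x.1 : Real.Angle) = (θ x : ℝ) := by
    have : ∀ᶠ x : ℂ × ℝ in 𝓝 y, x.1 ≠ 0 := continuousAt_fst.eventually_ne hy
    filter_upwards [this] with x hx
    simp only [hθ]
    rw [Complex.log_im, Real.Angle.coe_add, ← Complex.arg_mul_coe_angle (div_ne_zero hx hy) hy,
      div_mul_cancel₀ _ hy]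
  have hev : ∀ᶠ x in 𝓝 y, lensTransition p q m s (x.1, (x.2 : Real.Angle)) =
      (((1 - ‖x.1‖ : ℝ) : ℂ) * Complex.exp (((-q) * θ x + m * x.2 : ℝ) * Complex.I),
        ((p * θ x + s * x.2 : ℝ) : Real.Angle)) := by
    filter_upwards [hθa] with x hx
    have e1 : (-q) • ((θ x : ℝ) : Real.Angle) + m • (x.2 : Real.Angle) =
        ((-q * θ x + m * x.2 : ℝ) : Real.Angle) := by
      rw [← Real.Angle.coe_zsmul, ← Real.Angle.coe_zsmul, ← Real.Angle.coe_add]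
      simp
    have e2 : p • ((θ x : ℝ) : Real.Angle) + s • (x.2 : Real.Angle) =
        ((p * θ x + s * x.2 : ℝ) : Real.Angle) := by
      rw [← Real.Angle.coe_zsmul, ← Real.Angle.coe_zsmul, ← Real.Angle.coe_add]
      simp
    simp only [lensTransition, hx, e1, e2, Real.Angle.toCircle_coe, Circle.coe_exp]
  have hg : ContDiffAt ℝ ∞ (fun x : ℂ × ℝ => p * θ x + s * x.2) y := by fun_prop
  have hang : ContDiffAt ℝ ∞ (fun t : ℝ => (angleChart c).symm (t : Real.Angle))
      (p * θ y + s * y.2) := by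
    apply contDiffAt_angleChart
    rwa [hev.self_of_nhds] at hc
  have hn : ContDiffAt ℝ ∞ (fun x : ℂ × ℝ => ‖x.1‖) y :=
    (contDiffAt_norm ℝ hy).comp y contDiffAt_fst
  have hof : ContDiff ℝ ∞ (fun t : ℝ => (t : ℂ)) := Complex.ofRealCLM.contDiff
  have hfst : ContDiffAt ℝ ∞ (fun x : ℂ × ℝ => ((1 - ‖x.1‖ : ℝ) : ℂ) *
      Complex.exp (((-q) * θ x + m * x.2 : ℝ) * Complex.I)) y := by
    have h1 : ContDiffAt ℝ ∞ (fun x : ℂ × ℝ => ((1 - ‖x.1‖ : ℝ) : ℂ)) y :=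
      hof.contDiffAt.comp y (contDiffAt_const.sub hn)
    have h2 : ContDiffAt ℝ ∞ (fun x : ℂ × ℝ => (((-q) * θ x + m * x.2 : ℝ) : ℂ)) y :=
      hof.contDiffAt.comp y (by fun_prop)
    exact h1.mul (h2.mul contDiffAt_const).cexp
  refine (hfst.prodMk (hang.comp y hg)).congr_of_eventuallyEq ?_
  filter_upwards [hev] with x hx
  rw [hx]
  rfl

instance : IsManifold 𝓘(ℝ, ℂ × ℝ) ∞ (LensSpace p q m s h) := by
  refine isManifold_of_contDiffOn _ _ _ ?_
  rintro _ _ ⟨i, c, rfl⟩ ⟨j, c', rfl⟩ y hy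
  set S := 𝓘(ℝ, ℂ × ℝ).symm ⁻¹' ((chart i c : OpenPartialHomeomorph (LensSpace p q m s h)
    (ℂ × ℝ)).symm ≫ₕ chart j c').source ∩ range 𝓘(ℝ, ℂ × ℝ) with hS
  -- the points of the overlap, described on the two solid tori
  have key : ∀ x ∈ S, ∃ hx : x.1 ∈ Metric.ball (0 : ℂ) 1, ∃ v : SolidTorus,
      v.2 ≠ (c' : Real.Angle) ∧
      (psi j v : LensSpace p q m s h) = psi i (⟨x.1, hx⟩, (x.2 : Real.Angle)) := by
    rintro x ⟨hx, -⟩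
    obtain ⟨hx1, hx2⟩ := hx
    have hx1' : x ∈ (chart i c : OpenPartialHomeomorph (LensSpace p q m s h) (ℂ × ℝ)).target := hx1
    have hx2' : (chart i c).symm x ∈
      (chart j c' : OpenPartialHomeomorph (LensSpace p q m s h) (ℂ × ℝ)).source := hx2
    rw [chart_target] at hx1'
    have hb : x.1 ∈ Metric.ball (0 : ℂ) 1 := mem_ball_zero_iff.2 hx1'.1
    rw [chart_source, show x = (x.1, x.2) from rfl, chart_symm i c x.1 hb] at hx2'
    obtain ⟨v, hv, hv'⟩ := hx2'
    exact ⟨hb, v, hv, hv'⟩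
  have hval : ∀ x ∈ S, ∀ v : SolidTorus, ∀ hx : x.1 ∈ Metric.ball (0 : ℂ) 1,
      (psi j v : LensSpace p q m s h) = psi i (⟨x.1, hx⟩, (x.2 : Real.Angle)) →
      (𝓘(ℝ, ℂ × ℝ) ∘ ((chart i c : OpenPartialHomeomorph (LensSpace p q m s h)
        (ℂ × ℝ)).symm ≫ₕ chart j c') ∘ 𝓘(ℝ, ℂ × ℝ).symm) x =
      ((v.1 : ℂ), (angleChart c').symm v.2) := by
    intro x _ v hx hv
    change (chart j c') ((chart i c : OpenPartialHomeomorph (LensSpace p q m s h)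
        (ℂ × ℝ)).symm (x.1, x.2)) = _
    rw [chart_symm i c x.1 hx, ← hv, chart_psi]
  by_cases hij : i = j
  · subst hij
    obtain ⟨hx, v, hv, hvx⟩ := key y hy
    have hvy := psi_injective i hvx
    have hc : (y.2 : Real.Angle) ≠ c' := by
      rw [hvy] at hv
      exact hv
    have hsm : ContDiffAt ℝ ∞ (fun x : ℂ × ℝ => (x.1, (angleChart c').symm (x.2 : Real.Angle))) y :=
      contDiffAt_fst.prodMk ((contDiffAt_angleChart c' y.2 hc).comp y contDiffAt_snd)
    have hcongr : ∀ x ∈ S, (𝓘(ℝ, ℂ × ℝ) ∘ ((chart i c : OpenPartialHomeomorph (LensSpace p q m s h)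
        (ℂ × ℝ)).symm ≫ₕ chart i c') ∘ 𝓘(ℝ, ℂ × ℝ).symm) x =
        (x.1, (angleChart c').symm (x.2 : Real.Angle)) := by
      intro x hxS
      obtain ⟨hx, v, -, hvx⟩ := key x hxS
      rw [hval x hxS v hx hvx, psi_injective i hvx]
    exact hsm.contDiffWithinAt.congr hcongr (hcongr y hy)
  · -- the transition between the two tori, in either direction
    have key2 : ∃ q' s' : ℤ, ∀ u v : SolidTorus, (psi j v : LensSpace p q m s h) = psi i u →
        (u.1 : ℂ) ≠ 0 ∧ v.val = lensTransition p q' m s' u.val := by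
      have h01 : (j = 0 ∧ i = 1) ∨ (j = 1 ∧ i = 0) := by omega
      rcases h01 with ⟨rfl, rfl⟩ | ⟨rfl, rfl⟩
      · exact ⟨q, s, fun u v huv => (psi_zero_eq_psi_one v u).1 huv⟩
      · exact ⟨s, q, fun u v huv =>
          (lensRel_swap h u v).1 ((psi_zero_eq_psi_one u v).1 huv.symm)⟩
    obtain ⟨q', s', hqs⟩ := key2
    obtain ⟨hx, v, hv, hvx⟩ := key y hy
    obtain ⟨hy0, hvy⟩ := hqs _ v hvx
    have hsm := contDiffAt_lensTransition (p := p) (q := q') (m := m) (s := s') c' y hy0 (by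
      have : v.2 = (lensTransition p q' m s' (y.1, (y.2 : Real.Angle))).2 := congrArg Prod.snd hvy
      rwa [← this])
    have hcongr : ∀ x ∈ S, (𝓘(ℝ, ℂ × ℝ) ∘ ((chart i c : OpenPartialHomeomorph (LensSpace p q m s h)
        (ℂ × ℝ)).symm ≫ₕ chart j c') ∘ 𝓘(ℝ, ℂ × ℝ).symm) x =
        ((lensTransition p q' m s' (x.1, (x.2 : Real.Angle))).1,
        (angleChart c').symm (lensTransition p q' m s' (x.1, (x.2 : Real.Angle))).2) := by
      intro x hxS
      obtain ⟨hx, v, -, hvx⟩ := key x hxS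
      obtain ⟨-, hvx'⟩ := hqs _ v hvx
      rw [hval x hxS v hx hvx]
      exact congrArg (fun a : ℂ × Real.Angle => (a.1, (angleChart c').symm a.2)) hvx'
    exact hsm.contDiffWithinAt.congr hcongr (hcongr y hy)

open Classical in
/-- The chart `ψᵢ` in the coordinates `(w, z) ∈ ℂ × ℝ`, `‖w‖ < 1`, where `z` is taken modulo `2π`
(the value for `‖w‖ ≥ 1` is irrelevant). -/
def psiCoord (i : Fin 2) (y : ℂ × ℝ) : LensSpace p q m s h :=
  if hy : y.1 ∈ Metric.ball (0 : ℂ) 1 then psi i (⟨y.1, hy⟩, (y.2 : Real.Angle))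
  else psi i (⟨0, by simp⟩, 0)

theorem contMDiffOn_psiCoord (i : Fin 2) :
    ContMDiffOn 𝓘(ℝ, ℂ × ℝ) 𝓘(ℝ, ℂ × ℝ) ∞ (psiCoord i : ℂ × ℝ → LensSpace p q m s h)
      {y | ‖y.1‖ < 1} := by
  intro y hy
  replace hy : ‖y.1‖ < 1 := hy
  have hmem : y + 0 ∈ (chart i (y.2 - Real.pi) : OpenPartialHomeomorph (LensSpace p q m s h) (ℂ × ℝ)).target := by
    rw [chart_target]
    exact ⟨by simpa using hy, by simp; linarith [Real.pi_pos], by simp; linarith [Real.pi_pos]⟩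
  rw [add_zero] at hmem
  have h1 : ContMDiffOn 𝓘(ℝ, ℂ × ℝ) 𝓘(ℝ, ℂ × ℝ) ∞ (chart i (y.2 - Real.pi) : OpenPartialHomeomorph (LensSpace p q m s h) (ℂ × ℝ)).symm _ :=
    contMDiffOn_symm_of_mem_maximalAtlas (IsManifold.subset_maximalAtlas ⟨i, _, rfl⟩)
  have h2 := (h1 y hmem).contMDiffAt ((chart i (y.2 - Real.pi)).open_target.mem_nhds hmem)
  refine (h2.congr_of_eventuallyEq ?_).contMDiffWithinAt
  filter_upwards [(chart (h := h) i (y.2 - Real.pi)).open_target.mem_nhds hmem] with x hx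
  rw [chart_target] at hx
  have hb : x.1 ∈ Metric.ball (0 : ℂ) 1 := mem_ball_zero_iff.2 hx.1
  rw [show x = (x.1, x.2) from rfl, chart_symm i _ x.1 hb, psiCoord, dif_pos hb]

/-- The value `(η ∧ dη)(u, v, w)` at `y` for a differential one-form `η` on (a part of) `ℂ × ℝ`. -/
def wedgeExtDeriv (η : ℂ × ℝ → (ℂ × ℝ) →L[ℝ] ℝ) (y u v w : ℂ × ℝ) : ℝ :=
  let dη : (ℂ × ℝ) [⋀^Fin 2]→L[ℝ] ℝ :=
    extDeriv (fun x => ContinuousAlternatingMap.ofSubsingleton ℝ (ℂ × ℝ) ℝ (0 : Fin 1) (η x)) y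
  η y u * dη ![v, w] + η y v * dη ![w, u] + η y w * dη ![u, v]

/-- Smooth differential one-forms on `L(p, q)`: smooth sections of the cotangent bundle. -/
abbrev OneForm (p q m s : ℤ) (h : m * p + s * q = 1) : Type :=
  Cₛ^∞⟮𝓘(ℝ, ℂ × ℝ); (ℂ × ℝ) →L[ℝ] ℝ,
    fun x : LensSpace p q m s h => TangentSpace 𝓘(ℝ, ℂ × ℝ) x →L[ℝ] ℝ⟯

namespace OneForm

/-- The coordinate expression `ψᵢ^* α` of a one-form `α`, on `{(w, z) : ‖w‖ < 1}`. -/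
def coord (α : OneForm p q m s h) (i : Fin 2) (y : ℂ × ℝ) : (ℂ × ℝ) →L[ℝ] ℝ :=
  (α (psiCoord i y)).comp (mfderiv 𝓘(ℝ, ℂ × ℝ) 𝓘(ℝ, ℂ × ℝ) (psiCoord i) y)

/-- `α` is a positive contact form: `α ∧ dα > 0` for the orientation of `L(p, q)` in which both
`ψ₀` and `ψ₁` preserve orientation, `U` being oriented by `dx ∧ dy ∧ dz`. -/
def IsPositiveContact (α : OneForm p q m s h) : Prop :=
  ∀ (i : Fin 2) (y : ℂ × ℝ), ‖y.1‖ < 1 →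
    0 < wedgeExtDeriv (α.coord i) y (1, 0) (Complex.I, 0) (0, 1)

/-- `α` is associated with the triple `(a, τ₀, φ₀)`:
`ψ₀^* α = (τ₀ / 2π - φ₀ a(r)) dz + a(r) dθ` in the cylindrical coordinates of `U ∖ ℓ`.
Here `dθ` at the point `w = r e^{iθ} ≠ 0` is `v ↦ Im (v / w)`. -/
def IsAssociated (α : OneForm p q m s h) (a : ℝ → ℝ) (τ₀ φ₀ : ℝ) : Prop :=
  ∀ (w : ℂ) (z : ℝ), w ≠ 0 → ‖w‖ < 1 → ∀ (v : ℂ) (t : ℝ),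
    α.coord 0 (w, z) (v, t) =
      (τ₀ / (2 * Real.pi) - φ₀ * a ‖w‖) * t + a ‖w‖ * (v / w).im

end OneForm

/-- `Ψ^* β = α`. -/
def IsPullback (Ψ : LensSpace p q m s h → LensSpace p q m s h) (β α : OneForm p q m s h) : Prop :=
  ∀ x, (β (Ψ x)).comp (mfderiv 𝓘(ℝ, ℂ × ℝ) 𝓘(ℝ, ℂ × ℝ) Ψ x) = α x

end LensSpace

end

noncomputable section

/-! ### Smoothness of integrals along rays. -/

section RadialIntegral

variable {E : Type} [NormedAddCommGroup E] [NormedSpace ℝ E] [ProperSpace E]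

/-! Write `T = τ₀ / 2π`. In cylindrical coordinates `α ∧ dα = T a' dr ∧ dθ ∧ dz`
(`IsRadialForm.wedgeExtDeriv_eq`), so the contact condition forces `a' > 0` on `(0, 1)`. The form is
smooth across both cores, where `dθ` is singular, so its `dθ`-coefficient vanishes there. In the
second chart this coefficient is `pT - (q + pφ₀) a(1 - r)`; hence `a 0 = 0` and `(q + pφ₀) a 1 = pT`
(`coeff_zero`, `coeff_one`). Since `p, T > 0`, also `q + pφ₀ > 0`. Thus `a` and `b` increase
strictly between the same two values, and `ρ = b⁻¹ ∘ a` is the only candidate.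

Away from the cores `b ∘ ρ = a` gives the pullback identity at once, because a radial map preserves
`dθ` and `dz`. The real issue is smoothness at the cores. The function `a'(r) / r` is, up to the
factor `T`, the density of `α ∧ dα`, so it extends to a smooth positive function on the disc.
Integrating along rays gives `a(‖w‖) = ‖w‖² P(w)` with `P` smooth and positive
(`IsRadialForm.exists_eq_norm_sq_mul`). Then `w ↦ √P(w) w`, that is `r e^{iθ} ↦ √a(r) e^{iθ}`, is a
smooth injective local diffeomorphism, and so is its analogue for `b`. The radial map of `ρ` is the
first followed by the inverse of the second, hence smooth (`contDiffOn_radialMap`).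

The second chart has the same structure: its `dz`-coefficient is again `T' - φ' a₁`, with constants
`T' > 0` and `φ'` common to `α` and `β` (`exists_isRadialForm_coord`), so the same argument applies.
Exchanging `α` and `β` gives smoothness of the inverse. -/

theorem exists_bound_on_rays {F : Type} [NormedAddCommGroup F] {R : ℝ}
    {f : E → F} (hf : ContinuousOn f (Metric.ball 0 R)) {x : E} (hx : x ∈ Metric.ball 0 R) :
    ∃ C, ∃ U ∈ 𝓝 x, U ⊆ Metric.ball 0 R ∧ ∀ t ∈ Icc (0 : ℝ) 1, ∀ y ∈ U, ‖f y‖ ≤ C ∧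
      t • y ∈ Metric.ball 0 R ∧ ‖f (t • y)‖ ≤ C := by
  -- A closed ball of intermediate radius is compact, since `E` is proper, and star-shaped about
  -- `0`, so a single bound serves `y` and all `t • y`.
  obtain ⟨r, hxr, hrR⟩ := exists_between (mem_ball_zero_iff.1 hx)
  have hsub : Metric.closedBall (0 : E) r ⊆ Metric.ball 0 R := Metric.closedBall_subset_ball hrR
  obtain ⟨C, hC⟩ := (isCompact_closedBall (0 : E) r).exists_bound_of_continuousOn (hf.mono hsub)
  refine ⟨C, Metric.ball 0 r, Metric.isOpen_ball.mem_nhds (mem_ball_zero_iff.2 hxr),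
    Metric.ball_subset_closedBall.trans hsub, fun t ht y hy => ?_⟩
  have hy' := mem_ball_zero_iff.1 hy
  have hty : t • y ∈ Metric.closedBall (0 : E) r := by
    rw [mem_closedBall_zero_iff, norm_smul, Real.norm_of_nonneg ht.1]
    nlinarith [norm_nonneg y, ht.2]
  exact ⟨hC y (Metric.ball_subset_closedBall hy), hsub hty, hC _ hty⟩

theorem continuousOn_pow_smul_ray {F : Type} [NormedAddCommGroup F] [NormedSpace ℝ F] {R : ℝ}
    {f : E → F} (hf : ContinuousOn f (Metric.ball 0 R)) {x : E} (hx : x ∈ Metric.ball 0 R)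
    (k : ℕ) : ContinuousOn (fun t : ℝ => t ^ k • f (t • x)) (Icc 0 1) := by
  refine (by fun_prop : ContinuousOn (fun t : ℝ => t ^ k) (Icc 0 1)).smul
    (hf.comp (by fun_prop) fun t ht => ?_)
  obtain ⟨C, U, hU, -, h⟩ := exists_bound_on_rays hf hx
  exact (h t ht x (mem_of_mem_nhds hU)).2.1

/-- Differentiation under the integral sign replaces `(f, k)` by `(fderiv ℝ f, k + 1)`, the extra
`t` coming from the chain rule. The induction on `n` therefore has to leave both `k` and the target
space free. -/
theorem contDiffOn_integral_pow_smul_ray {R : ℝ} (n : ℕ) : ∀ {F : Type} [NormedAddCommGroup F]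
    [NormedSpace ℝ F] (k : ℕ) {f : E → F}, ContDiffOn ℝ n f (Metric.ball 0 R) →
    ContDiffOn ℝ n (fun x => ∫ t in (0 : ℝ)..1, t ^ k • f (t • x)) (Metric.ball 0 R) := by
  have hI : uIoc (0 : ℝ) 1 ⊆ Icc 0 1 := by
    rw [uIoc_of_le zero_le_one]; exact Ioc_subset_Icc_self
  have hpow : ∀ t ∈ Icc (0 : ℝ) 1, ∀ k : ℕ, |t| ^ k ≤ 1 := fun t ht k =>
    pow_le_one₀ (abs_nonneg _) (by rw [abs_of_nonneg ht.1]; exact ht.2)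
  have hmeas : ∀ {F : Type} [NormedAddCommGroup F] [NormedSpace ℝ F] (k : ℕ) {f : E → F},
      ContinuousOn f (Metric.ball 0 R) → ∀ x ∈ Metric.ball (0 : E) R,
      MeasureTheory.AEStronglyMeasurable (fun t : ℝ => t ^ k • f (t • x))
        (MeasureTheory.volume.restrict (uIoc (0 : ℝ) 1)) := by
    intro F _ _ k f hf x hx
    exact ((continuousOn_pow_smul_ray hf hx k).mono hI).aestronglyMeasurable measurableSet_uIoc
  induction n with
  | zero =>
    intro F _ _ k f hf
    have hf : ContinuousOn f (Metric.ball 0 R) := (contDiffOn_zero (𝕜 := ℝ)).1 (by simpa using hf)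
    refine (contDiffOn_zero (𝕜 := ℝ)).2 fun x hx => ContinuousAt.continuousWithinAt ?_
    obtain ⟨C, U, hU, hUR, hC⟩ := exists_bound_on_rays hf hx
    refine intervalIntegral.continuousAt_of_dominated_interval (bound := fun _ => C) ?_ ?_
      (by simp) ?_
    · filter_upwards [hU] with y hy using hmeas k hf y (hUR hy)
    · filter_upwards [hU] with y hy
      refine Filter.Eventually.of_forall fun t ht => ?_
      have := (hC t (hI ht) y hy).2.2
      rw [norm_smul, norm_pow, Real.norm_eq_abs]
      nlinarith [hpow t (hI ht) k, norm_nonneg (f (t • y)), pow_nonneg (abs_nonneg t) k]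
    · refine Filter.Eventually.of_forall fun t ht => ?_
      have h1 : ContinuousAt f (t • x) := hf.continuousAt
        (Metric.isOpen_ball.mem_nhds (hC t (hI ht) x (mem_of_mem_nhds hU)).2.1)
      have h2 : ContinuousAt (fun y : E => t • y) x := by fun_prop
      exact (ContinuousAt.comp (f := fun y : E => t • y) h1 h2).const_smul _
  | succ n ih =>
    intro F _ _ k f hf
    rw [Nat.cast_add, Nat.cast_one] at hf ⊢
    have hfd := (contDiffOn_succ_iff_fderiv_of_isOpen Metric.isOpen_ball).1 hf
    have hf0 : ContinuousOn f (Metric.ball 0 R) := hf.continuousOn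
    have hf1 : ContinuousOn (fderiv ℝ f) (Metric.ball 0 R) := hfd.2.2.continuousOn
    have hder : ∀ x ∈ Metric.ball (0 : E) R,
        HasFDerivAt (fun x => ∫ t in (0 : ℝ)..1, t ^ k • f (t • x))
          (∫ t in (0 : ℝ)..1, t ^ (k + 1) • fderiv ℝ f (t • x)) x := by
      intro x hx
      obtain ⟨C, U, hU, hUR, hC⟩ := exists_bound_on_rays hf1 hx
      refine intervalIntegral.hasFDerivAt_integral_of_dominated_of_fderiv_le (𝕜 := ℝ)
        (bound := fun _ => C) hU
        (F' := fun x t => t ^ (k + 1) • fderiv ℝ f (t • x)) ?_ ?_ (hmeas _ hf1 x hx) ?_ (by simp) ?_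
      · filter_upwards [hU] with y hy using hmeas k hf0 y (hUR hy)
      · exact ContinuousOn.intervalIntegrable (by
          rw [uIcc_of_le zero_le_one]; exact continuousOn_pow_smul_ray hf0 hx k)
      · refine Filter.Eventually.of_forall fun t ht y hy => ?_
        have := (hC t (hI ht) y hy).2.2
        rw [norm_smul, norm_pow, Real.norm_eq_abs]
        nlinarith [hpow t (hI ht) (k + 1), norm_nonneg (fderiv ℝ f (t • y)),
          pow_nonneg (abs_nonneg t) (k + 1)]
      · refine Filter.Eventually.of_forall fun t ht y hy => ?_
        have h1 : HasFDerivAt f (fderiv ℝ f (t • y)) (t • y) :=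
          (hfd.1.differentiableAt
            (Metric.isOpen_ball.mem_nhds (hC t (hI ht) y hy).2.1)).hasFDerivAt
        have h2 := (h1.comp y ((hasFDerivAt_id y).const_smul t)).const_smul (t ^ k)
        have e : t ^ (k + 1) • fderiv ℝ f (t • y) =
            t ^ k • (fderiv ℝ f (t • y)).comp (t • ContinuousLinearMap.id ℝ E) := by
          rw [ContinuousLinearMap.comp_smul, ContinuousLinearMap.comp_id, smul_smul, pow_succ]
        rw [e]
        exact h2
    refine (contDiffOn_succ_iff_fderiv_of_isOpen Metric.isOpen_ball).2
      ⟨fun x hx => (hder x hx).differentiableAt.differentiableWithinAt, by simp, ?_⟩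
    exact (ih (k + 1) hfd.2.2).congr fun x hx => (hder x hx).fderiv

end RadialIntegral

/-! ### Radial one-forms on the solid torus and the contact condition. -/

theorem extDeriv_ofSubsingleton_apply {E : Type*} [NormedAddCommGroup E] [NormedSpace ℝ E]
    {η : E → E →L[ℝ] ℝ} {y : E} (hη : DifferentiableAt ℝ η y) (u v : E) :
    extDeriv (fun x => ContinuousAlternatingMap.ofSubsingleton ℝ E ℝ (0 : Fin 1) (η x)) y ![u, v] =
      fderiv ℝ η y u v - fderiv ℝ η y v u := by
  have hd : DifferentiableAt ℝ
      (fun x => ContinuousAlternatingMap.ofSubsingleton ℝ E ℝ (0 : Fin 1) (η x)) y :=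
    (ContinuousAlternatingMap.ofSubsingletonLIE (𝕜 := ℝ) (E := E) (F := ℝ) (0 : Fin 1)).differentiableAt.comp y hη
  have h1 : ∀ v : E, fderiv ℝ (fun x => η x v) y = (fderiv ℝ η y).flip v := fun v =>
    (hη.hasFDerivAt.clm_apply (hasFDerivAt_const v y)).fderiv.trans (by ext; simp)
  rw [extDeriv_apply hd, Fin.sum_univ_two]
  simp [h1, Fin.removeNth, sub_eq_add_neg]

/-- In the cylindrical coordinates `w = r e^{iθ}`, the one-form `η` on `{(w, z) : 0 < ‖w‖ < 1}` is
`(T - φ a(r)) dz + a(r) dθ`. -/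
def IsRadialForm (η : ℂ × ℝ → (ℂ × ℝ) →L[ℝ] ℝ) (a : ℝ → ℝ) (T φ : ℝ) : Prop :=
  ∀ (w : ℂ) (z : ℝ), w ≠ 0 → ‖w‖ < 1 → ∀ (v : ℂ) (t : ℝ),
    η (w, z) (v, t) = (T - φ * a ‖w‖) * t + a ‖w‖ * (v / w).im

theorem isOpen_norm_fst_lt : IsOpen {y : ℂ × ℝ | ‖y.1‖ < 1} :=
  isOpen_lt (by fun_prop) continuous_const

theorem hasFDerivAt_norm_complex {w : ℂ} (hw : w ≠ 0) :
    HasFDerivAt (fun x : ℂ => ‖x‖) ((‖w‖⁻¹ : ℝ) • innerSL ℝ w) w := by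
  have h1 := (hasStrictFDerivAt_norm_sq w).hasFDerivAt.sqrt
    (by have := norm_pos_iff.2 hw; positivity)
  simp only [Real.sqrt_sq (norm_nonneg _)] at h1
  refine h1.congr_fderiv ?_
  ext
  all_goals
    simp
    ring

/-- The field `∂_θ`, which is `I * w` at `w`, tends to zero at the core, and `η` is continuous
there. The hypothesis is weaker than `IsRadialForm` because in the second chart this vanishing is
needed first: it yields `q + pφ₀ > 0`, by which the constants of that chart are divided. -/
theorem eq_zero_of_apply_I_mul {η : ℂ × ℝ → (ℂ × ℝ) →L[ℝ] ℝ} {a : ℝ → ℝ}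
    (h : ∀ w : ℂ, w ≠ 0 → ‖w‖ < 1 → η (w, 0) (Complex.I * w, 0) = a ‖w‖)
    (hη : ContDiffOn ℝ ∞ η {y | ‖y.1‖ < 1})
    (ha : ContinuousOn a (Icc 0 1)) : a 0 = 0 := by
  have hmem : ((0 : ℂ), (0 : ℝ)) ∈ {y : ℂ × ℝ | ‖y.1‖ < 1} := by simp
  have h1 : ContinuousAt η ((0 : ℂ), 0) :=
    (hη.contDiffAt (isOpen_norm_fst_lt.mem_nhds hmem)).continuousAt
  have h2 : ContinuousAt (fun x : ℝ => η ((x : ℂ), 0) (Complex.I * x, 0)) 0 := by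
    have h3 : ContinuousAt (fun x : ℝ => ((x : ℂ), (0 : ℝ))) 0 := by fun_prop
    exact (ContinuousAt.comp (f := fun x : ℝ => ((x : ℂ), (0 : ℝ))) (by simpa using h1)
      h3).clm_apply (by fun_prop)
  have h4 : Filter.Tendsto a (𝓝[>] 0) (𝓝 (a 0)) :=
    (ha 0 (by simp)).mono_left (nhdsWithin_le_of_mem (Icc_mem_nhdsGT zero_lt_one))
  have h5 : Filter.Tendsto (fun x : ℝ => η ((x : ℂ), 0) (Complex.I * x, 0)) (𝓝[>] 0) (𝓝 0) := by
    have : η (((0 : ℝ) : ℂ), 0) (Complex.I * ((0 : ℝ) : ℂ), 0) = 0 := by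
      simp [← Prod.zero_eq_mk]
    have h6 := h2.tendsto
    rw [this] at h6
    exact h6.mono_left nhdsWithin_le_nhds
  refine tendsto_nhds_unique (h4.congr' ?_) h5
  filter_upwards [Ioo_mem_nhdsGT (zero_lt_one' ℝ)] with x hx
  rw [h x (by simpa using hx.1.ne') (by simpa [abs_of_pos hx.1] using hx.2)]
  simp [abs_of_pos hx.1]

namespace IsRadialForm

variable {η : ℂ × ℝ → (ℂ × ℝ) →L[ℝ] ℝ} {a : ℝ → ℝ} {T φ : ℝ}

theorem apply_I_mul (h : IsRadialForm η a T φ) {w : ℂ} (hw : w ≠ 0) (hw1 : ‖w‖ < 1) :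
    η (w, 0) (Complex.I * w, 0) = a ‖w‖ := by
  simp [h w 0 hw hw1, mul_div_assoc, div_self hw]

/-- On the positive real axis `a` is recovered from the smooth form by evaluation on `∂_θ`. -/
theorem hasDerivAt (h : IsRadialForm η a T φ) (hη : ContDiffOn ℝ ∞ η {y | ‖y.1‖ < 1})
    {r : ℝ} (hr : r ∈ Ioo (0 : ℝ) 1) : HasDerivAt a (deriv a r) r := by
  have hmem : ((r : ℂ), (0 : ℝ)) ∈ {y : ℂ × ℝ | ‖y.1‖ < 1} := by
    simpa [abs_of_pos hr.1] using hr.2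
  have h1 : DifferentiableAt ℝ η ((r : ℂ), 0) :=
    (hη.contDiffAt (isOpen_norm_fst_lt.mem_nhds hmem)).differentiableAt (by simp)
  have h2 : DifferentiableAt ℝ (fun x : ℝ => η ((x : ℂ), 0) (Complex.I * x, 0)) r := by
    have h3 : DifferentiableAt ℝ (fun x : ℝ => ((x : ℂ), (0 : ℝ))) r :=
      Complex.ofRealCLM.differentiableAt.prodMk (differentiableAt_const _)
    have h4 : DifferentiableAt ℝ (fun x : ℝ => (Complex.I * (x : ℂ), (0 : ℝ))) r :=
      (Complex.ofRealCLM.differentiableAt.const_mul _).prodMk (differentiableAt_const _)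
    exact (DifferentiableAt.comp (f := fun x : ℝ => ((x : ℂ), (0 : ℝ))) r h1 h3).clm_apply h4
  refine (h2.congr_of_eventuallyEq ?_).hasDerivAt
  filter_upwards [isOpen_Ioo.mem_nhds hr] with x hx
  rw [h.apply_I_mul (by simpa using hx.1.ne') (by simpa [abs_of_pos hx.1] using hx.2)]
  simp [abs_of_pos hx.1]

/-- For `η = (T - φa) dz + a dθ` one has `dη = a' dr ∧ (dθ - φ dz)`. In `η ∧ dη` the terms with `φ a
a'` cancel, and `dx ∧ dy ∧ dz = r dr ∧ dθ ∧ dz` accounts for the denominator. -/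
theorem wedgeExtDeriv_eq (h : IsRadialForm η a T φ) (hη : ContDiffOn ℝ ∞ η {y | ‖y.1‖ < 1})
    {w : ℂ} (hw : w ≠ 0) (hw1 : ‖w‖ < 1) (z : ℝ) :
    LensSpace.wedgeExtDeriv η (w, z) (1, 0) (Complex.I, 0) (0, 1) = T * deriv a ‖w‖ / ‖w‖ := by
  have hmem : (w, z) ∈ {y : ℂ × ℝ | ‖y.1‖ < 1} := hw1
  have hd : DifferentiableAt ℝ η (w, z) :=
    (hη.contDiffAt (isOpen_norm_fst_lt.mem_nhds hmem)).differentiableAt (by simp)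
  have ha := h.hasDerivAt hη ⟨norm_pos_iff.2 hw, hw1⟩
  -- the derivative of `y ↦ a ‖y.1‖`
  have hA : HasFDerivAt (fun y : ℂ × ℝ => a ‖y.1‖)
      ((deriv a ‖w‖ * ‖w‖⁻¹) • (innerSL ℝ w).comp (ContinuousLinearMap.fst ℝ ℂ ℝ)) (w, z) := by
    have := ha.comp_hasFDerivAt (w, z) ((hasFDerivAt_norm_complex hw).comp (w, z)
      (hasFDerivAt_fst (𝕜 := ℝ) (E := ℂ) (F := ℝ)))
    exact this.congr_fderiv (by ext <;> simp [mul_assoc])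
  -- The last term, the derivative of `dθ`, is symmetric in `u` and `v`, so it drops out of the
  -- exterior derivative.
  have key : ∀ u v : ℂ × ℝ, fderiv ℝ η (w, z) u v =
      deriv a ‖w‖ * ‖w‖⁻¹ * inner ℝ w u.1 * ((v.1 / w).im - φ * v.2) -
        a ‖w‖ * (v.1 * u.1 / w ^ 2).im := by
    intro u v
    have hinv : HasFDerivAt (fun y : ℂ × ℝ => (v.1 / y.1).im)
        (Complex.imCLM.comp (((-(v.1 / w ^ 2)) • (1 : ℂ →L[ℝ] ℂ)).comp
          (ContinuousLinearMap.fst ℝ ℂ ℝ))) (w, z) := by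
      have h1 : HasDerivAt (fun x : ℂ => v.1 / x) (-(v.1 / w ^ 2)) w := by
        have := (hasDerivAt_inv hw).const_mul v.1
        simp only [← div_eq_mul_inv] at this
        exact this.congr_deriv (by rw [div_eq_mul_inv]; ring)
      have h2 := h1.complexToReal_fderiv
      exact Complex.imCLM.hasFDerivAt.comp (w, z) (h2.comp (w, z)
        (hasFDerivAt_fst (𝕜 := ℝ) (E := ℂ) (F := ℝ)))
    have h2 := (((hasFDerivAt_const T (w, z)).sub (hA.const_mul φ)).mul_const v.2).add
      (hA.mul hinv)
    have h3 : HasFDerivAt (fun y => η y v) ((fderiv ℝ η (w, z)).flip v) (w, z) := by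
      exact (hd.hasFDerivAt.clm_apply (hasFDerivAt_const v (w, z))).congr_fderiv (by ext <;> simp)
    have h4 := h3.unique (h2.congr_of_eventuallyEq (by
      have e1 : ∀ᶠ y : ℂ × ℝ in 𝓝 (w, z), y.1 ≠ 0 := continuousAt_fst.eventually_ne hw
      filter_upwards [e1, isOpen_norm_fst_lt.mem_nhds hmem] with y hy hy1
      exact h y.1 y.2 hy hy1 v.1 v.2))
    have h5 := congrArg (fun L => L u) h4
    simp only [ContinuousLinearMap.flip_apply] at h5
    rw [h5]
    have e : v.1 * u.1 / w ^ 2 = v.1 / w ^ 2 * u.1 := by ring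
    rw [e]
    simp
    ring
  have hn : ‖w‖ ^ 2 = w.re ^ 2 + w.im ^ 2 := by
    rw [Complex.sq_norm, Complex.normSq_apply]; ring
  have hr : ‖w‖ ≠ 0 := norm_ne_zero_iff.2 hw
  rw [LensSpace.wedgeExtDeriv]
  simp only [extDeriv_ofSubsingleton_apply hd, key, h w z hw hw1]
  have i1 : ((1 : ℂ) / w).im = - w.im / ‖w‖ ^ 2 := by
    rw [one_div, Complex.inv_im, Complex.sq_norm]
  have i2 : (Complex.I / w).im = w.re / ‖w‖ ^ 2 := by
    rw [div_eq_mul_inv, Complex.I_mul_im, Complex.inv_re, Complex.sq_norm]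
  have j1 : inner ℝ w (1 : ℂ) = w.re := by simp [Complex.inner]
  have j2 : inner ℝ w Complex.I = w.im := by simp [Complex.inner]
  simp only [i1, i2, j1, j2, mul_comm Complex.I (1 : ℂ)]
  simp
  field_simp
  rw [hn]
  ring

theorem eq_zero (h : IsRadialForm η a T φ) (hη : ContDiffOn ℝ ∞ η {y | ‖y.1‖ < 1})
    (ha : ContinuousOn a (Icc 0 1)) : a 0 = 0 :=
  eq_zero_of_apply_I_mul (fun _ => h.apply_I_mul) hη ha

theorem deriv_pos (h : IsRadialForm η a T φ) (hη : ContDiffOn ℝ ∞ η {y | ‖y.1‖ < 1})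
    (hT : 0 < T) (hpos : ∀ y : ℂ × ℝ, ‖y.1‖ < 1 →
      0 < LensSpace.wedgeExtDeriv η y (1, 0) (Complex.I, 0) (0, 1))
    {r : ℝ} (hr : r ∈ Ioo (0 : ℝ) 1) : 0 < deriv a r := by
  have hn : ‖(r : ℂ)‖ = r := by simp [abs_of_pos hr.1]
  have h1 := hpos ((r : ℂ), 0) (hn.trans_lt hr.2)
  rw [h.wedgeExtDeriv_eq hη (by simpa using hr.1.ne') (hn.trans_lt hr.2), hn] at h1
  have h2 := (div_pos_iff_of_pos_right hr.1).1 h1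
  exact (mul_pos_iff_of_pos_left hT).1 h2

theorem strictMonoOn (h : IsRadialForm η a T φ) (hη : ContDiffOn ℝ ∞ η {y | ‖y.1‖ < 1})
    (hT : 0 < T) (hpos : ∀ y : ℂ × ℝ, ‖y.1‖ < 1 →
      0 < LensSpace.wedgeExtDeriv η y (1, 0) (Complex.I, 0) (0, 1))
    (ha : ContinuousOn a (Icc 0 1)) : StrictMonoOn a (Icc 0 1) :=
  strictMonoOn_of_deriv_pos (convex_Icc 0 1) ha fun r hr =>
    h.deriv_pos hη hT hpos (by simpa using hr)

/-- The coefficient `a` vanishes to exactly second order along the core, smoothly. -/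
theorem exists_eq_norm_sq_mul (h : IsRadialForm η a T φ)
    (hη : ContDiffOn ℝ ∞ η {y | ‖y.1‖ < 1})
    (hT : 0 < T) (hpos : ∀ y : ℂ × ℝ, ‖y.1‖ < 1 →
      0 < LensSpace.wedgeExtDeriv η y (1, 0) (Complex.I, 0) (0, 1))
    (ha : ContinuousOn a (Icc 0 1)) :
    ∃ P : ℂ → ℝ, ContDiffOn ℝ ∞ P (Metric.ball 0 1) ∧ (∀ w ∈ Metric.ball 0 1, 0 < P w) ∧
      ∀ w ∈ Metric.ball 0 1, a ‖w‖ = ‖w‖ ^ 2 * P w := by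
  -- Off the core `G` is `a'(r) / r`; defined through `η`, it is visibly smooth and positive at the
  -- core as well.
  set G : ℂ → ℝ := fun w =>
    LensSpace.wedgeExtDeriv η (w, 0) (1, 0) (Complex.I, 0) (0, 1) / T with hG
  have hGs : ContDiffOn ℝ ∞ G (Metric.ball 0 1) := by
    intro w hw
    have hw1 := mem_ball_zero_iff.1 hw
    have hfd : ContDiffOn ℝ ∞ (fderiv ℝ η) {y | ‖y.1‖ < 1} :=
      hη.fderiv_of_isOpen isOpen_norm_fst_lt (by simp)
    have hmaps : MapsTo (fun w : ℂ => (w, (0 : ℝ))) (Metric.ball 0 1) {y | ‖y.1‖ < 1} :=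
      fun w hw => mem_ball_zero_iff.1 hw
    have c1 : ContDiffOn ℝ ∞ (fun w : ℂ => η (w, 0)) (Metric.ball 0 1) :=
      hη.comp (by fun_prop) hmaps
    have c2 : ContDiffOn ℝ ∞ (fun w : ℂ => fderiv ℝ η (w, 0)) (Metric.ball 0 1) :=
      hfd.comp (by fun_prop) hmaps
    have c3 : ∀ u : ℂ × ℝ, ContDiffOn ℝ ∞ (fun w : ℂ => η (w, 0) u) (Metric.ball 0 1) :=
      fun u => c1.clm_apply contDiffOn_const
    have c4 : ∀ u v : ℂ × ℝ,
        ContDiffOn ℝ ∞ (fun w : ℂ => fderiv ℝ η (w, 0) u v) (Metric.ball 0 1) :=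
      fun u v => (c2.clm_apply contDiffOn_const).clm_apply contDiffOn_const
    refine ContDiffOn.congr (f := fun w : ℂ =>
      (η (w, 0) (1, 0) * (fderiv ℝ η (w, 0) (Complex.I, 0) (0, 1) -
          fderiv ℝ η (w, 0) (0, 1) (Complex.I, 0)) +
        η (w, 0) (Complex.I, 0) * (fderiv ℝ η (w, 0) (0, 1) (1, 0) -
          fderiv ℝ η (w, 0) (1, 0) (0, 1)) +
        η (w, 0) (0, 1) * (fderiv ℝ η (w, 0) (1, 0) (Complex.I, 0) -
          fderiv ℝ η (w, 0) (Complex.I, 0) (1, 0))) / T) ?_ ?_ w hw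
    · exact ((((c3 _).mul ((c4 _ _).sub (c4 _ _))).add ((c3 _).mul ((c4 _ _).sub (c4 _ _)))).add
        ((c3 _).mul ((c4 _ _).sub (c4 _ _)))).div_const T
    · intro x hx
      have hd : DifferentiableAt ℝ η (x, 0) :=
        (hη.contDiffAt (isOpen_norm_fst_lt.mem_nhds (hmaps hx))).differentiableAt (by simp)
      simp only [hG, LensSpace.wedgeExtDeriv, extDeriv_ofSubsingleton_apply hd]
  have hGpos : ∀ w ∈ Metric.ball (0 : ℂ) 1, 0 < G w := fun w hw =>
    div_pos (hpos (w, 0) (mem_ball_zero_iff.1 hw)) hT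
  have hray : ∀ w ∈ Metric.ball (0 : ℂ) 1, ContinuousOn (fun t : ℝ => t ^ 1 • G (t • w)) (Icc 0 1) :=
    fun w hw => continuousOn_pow_smul_ray hGs.continuousOn hw 1
  have hmem : ∀ w ∈ Metric.ball (0 : ℂ) 1, ∀ t ∈ Icc (0 : ℝ) 1, t • w ∈ Metric.ball (0 : ℂ) 1 :=
    fun w hw t ht => by
      obtain ⟨C, U, hU, -, h⟩ := exists_bound_on_rays hGs.continuousOn hw
      exact (h t ht w (mem_of_mem_nhds hU)).2.1
  -- The witness comes from `d/dt a(t‖w‖) = ‖w‖ a'(t‖w‖) = ‖w‖² t G(tw)`, integrated over `[0, 1]`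
  -- with `a 0 = 0`.
  refine ⟨fun w => ∫ t in (0 : ℝ)..1, t ^ 1 • G (t • w), ?_, ?_, ?_⟩
  · exact contDiffOn_infty.2 fun n => contDiffOn_integral_pow_smul_ray n 1 (contDiffOn_infty.1 hGs n)
  · intro w hw
    refine intervalIntegral.intervalIntegral_pos_of_pos_on ?_ (fun t ht => ?_) zero_lt_one
    · exact ContinuousOn.intervalIntegrable (by
        rw [uIcc_of_le zero_le_one]; exact hray w hw)
    · have := hGpos _ (hmem w hw t (Ioo_subset_Icc_self ht))
      have := ht.1
      simp only [pow_one, smul_eq_mul]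
      positivity
  · intro w hw
    rcases eq_or_ne w 0 with rfl | hw0
    · simp [h.eq_zero hη ha]
    have hw1 := mem_ball_zero_iff.1 hw
    have hr := norm_pos_iff.2 hw0
    have hftc : ∫ t in (0 : ℝ)..1, ‖w‖ ^ 2 * (t ^ 1 • G (t • w)) =
        a (1 * ‖w‖) - a (0 * ‖w‖) := by
      refine intervalIntegral.integral_eq_sub_of_hasDerivAt_of_le zero_le_one
        (f := fun t => a (t * ‖w‖)) ?_ ?_ ?_
      · refine ha.comp (by fun_prop) fun t ht => ⟨mul_nonneg ht.1 hr.le, ?_⟩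
        nlinarith [ht.2, ht.1]
      · intro t ht
        have hmem' : t * ‖w‖ ∈ Ioo (0 : ℝ) 1 := ⟨mul_pos ht.1 hr, by nlinarith [ht.1, ht.2]⟩
        have h1 := (h.hasDerivAt hη hmem').comp t ((hasDerivAt_id t).mul_const ‖w‖)
        refine h1.congr_deriv ?_
        have hn : ‖t • w‖ = t * ‖w‖ := by rw [norm_smul, Real.norm_of_nonneg ht.1.le]
        simp only [G]
        rw [h.wedgeExtDeriv_eq hη (smul_ne_zero ht.1.ne' hw0) (by rw [hn]; exact hmem'.2), hn]
        have := ht.1.ne'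
        simp
        field_simp
      · exact ContinuousOn.intervalIntegrable (by
          rw [uIcc_of_le zero_le_one]; exact continuousOn_const.mul (hray w hw))
    rw [intervalIntegral.integral_const_mul] at hftc
    simpa [h.eq_zero hη ha] using hftc.symm

end IsRadialForm

/-! ### Smoothness of radial maps across the core. -/

theorem ContDiffAt.exists_contDiffAt_rightInverse {E : Type*} [NormedAddCommGroup E]
    [NormedSpace ℝ E] [FiniteDimensional ℝ E] {f : E → E} {x : E} (hf : ContDiffAt ℝ ∞ f x)
    (hinj : Function.Injective (fderiv ℝ f x)) :
    ∃ g : E → E, ContDiffAt ℝ ∞ g (f x) ∧ g (f x) = x ∧ ∀ᶠ y in 𝓝 (f x), f (g y) = y := by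
  let e : E ≃L[ℝ] E :=
    (LinearEquiv.ofInjectiveEndo (fderiv ℝ f x : E →ₗ[ℝ] E) hinj).toContinuousLinearEquiv
  have he : (e : E →L[ℝ] E) = fderiv ℝ f x := by ext v; rfl
  have hd : HasFDerivAt f (e : E →L[ℝ] E) x := by
    rw [he]; exact (hf.differentiableAt (by simp)).hasFDerivAt
  have hs := hf.hasStrictFDerivAt' hd (by simp)
  exact ⟨hf.localInverse hd (by simp), hf.to_localInverse hd (by simp),
    hf.localInverse_apply_image hd (by simp), hs.eventually_right_inverse⟩

/-- The map `r e^{iθ} ↦ ρ(r) e^{iθ}`. -/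
def radialMap (ρ : ℝ → ℝ) (w : ℂ) : ℂ := ((ρ ‖w‖ / ‖w‖ : ℝ) : ℂ) * w

section radialMap

variable {ρ : ℝ → ℝ}

@[simp] theorem radialMap_zero : radialMap ρ 0 = 0 := by simp [radialMap]

theorem norm_radialMap {w : ℂ} (hw : w ≠ 0) (h : 0 ≤ ρ ‖w‖) : ‖radialMap ρ w‖ = ρ ‖w‖ := by
  have := norm_ne_zero_iff.2 hw
  rw [radialMap, norm_mul, Complex.norm_real, Real.norm_of_nonneg (by positivity)]
  field_simp

theorem radialMap_mul_exp {r : ℝ} (hr : 0 ≤ r) (h0 : ρ 0 = 0) (θ : ℝ) :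
    radialMap ρ (r * Complex.exp (θ * Complex.I)) = ρ r * Complex.exp (θ * Complex.I) := by
  have hn : ‖(r : ℂ) * Complex.exp (θ * Complex.I)‖ = r := by
    rw [norm_mul, Complex.norm_exp_ofReal_mul_I, mul_one, Complex.norm_real,
      Real.norm_of_nonneg hr]
  rw [radialMap, hn]
  rcases eq_or_ne r 0 with rfl | hr0
  · simp [h0]
  · rw [← mul_assoc, ← Complex.ofReal_mul, div_mul_cancel₀ _ hr0]

/-- The map `r e^{iθ} ↦ √a(r) e^{iθ}`, for `a(r) = r² P`. -/
def sqrtRadialMap (P : ℂ → ℝ) (w : ℂ) : ℂ := √(P w) • w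

variable {P Q : ℂ → ℝ} {a b : ℝ → ℝ}

theorem sq_norm_sqrtRadialMap (hP : ∀ w ∈ Metric.ball 0 1, 0 < P w)
    (ha : ∀ w ∈ Metric.ball 0 1, a ‖w‖ = ‖w‖ ^ 2 * P w) {w : ℂ} (hw : w ∈ Metric.ball 0 1) :
    ‖sqrtRadialMap P w‖ ^ 2 = a ‖w‖ := by
  rw [sqrtRadialMap, norm_smul, mul_pow, Real.norm_eq_abs, sq_abs, Real.sq_sqrt (hP w hw).le,
    ha w hw, mul_comm]

/-- The image determines `a ‖w‖`, hence `‖w‖` by monotonicity, hence `P w` when `w ≠ 0`; what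
remains is multiplication by one positive scalar. -/
theorem sqrtRadialMap_injOn (hP : ∀ w ∈ Metric.ball 0 1, 0 < P w)
    (ha : ∀ w ∈ Metric.ball 0 1, a ‖w‖ = ‖w‖ ^ 2 * P w) (hmono : StrictMonoOn a (Icc 0 1)) :
    InjOn (sqrtRadialMap P) (Metric.ball 0 1) := by
  intro w hw w' hw' h
  have hmem : ∀ w ∈ Metric.ball (0 : ℂ) 1, ‖w‖ ∈ Icc (0 : ℝ) 1 := fun w hw =>
    ⟨norm_nonneg _, (mem_ball_zero_iff.1 hw).le⟩
  have hn : ‖w‖ = ‖w'‖ := hmono.injOn (hmem w hw) (hmem w' hw') (by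
    rw [← sq_norm_sqrtRadialMap hP ha hw, ← sq_norm_sqrtRadialMap hP ha hw', h])
  rcases eq_or_ne w 0 with rfl | hw0
  · exact (norm_eq_zero.1 (by rw [← hn, norm_zero])).symm
  have hPP : P w = P w' := by
    have h1 := ha w hw
    have h2 := ha w' hw'
    rw [← hn, h1] at h2
    exact mul_left_cancel₀ (pow_ne_zero 2 (norm_ne_zero_iff.2 hw0)) h2
  simp only [sqrtRadialMap, hPP] at h
  exact smul_right_injective ℂ (Real.sqrt_pos.2 (hP w' hw')).ne' h

theorem contDiffOn_sqrtRadialMap (hPs : ContDiffOn ℝ ∞ P (Metric.ball 0 1))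
    (hP : ∀ w ∈ Metric.ball 0 1, 0 < P w) :
    ContDiffOn ℝ ∞ (sqrtRadialMap P) (Metric.ball 0 1) :=
  (hPs.sqrt fun w hw => (hP w hw).ne').smul contDiffOn_id

/-- The derivative is `v ↦ √P v + (d√P)(v) w`, so a kernel vector is a real multiple `c w`. For `w ≠
0`, differentiating `‖√P w‖² = a(‖w‖)` in that direction gives `0 = c ‖w‖ a'(‖w‖)`, and `a' > 0`
forces `c = 0`. -/
theorem fderiv_sqrtRadialMap_injective (hPs : ContDiffOn ℝ ∞ P (Metric.ball 0 1))
    (hP : ∀ w ∈ Metric.ball 0 1, 0 < P w)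
    (ha : ∀ w ∈ Metric.ball 0 1, a ‖w‖ = ‖w‖ ^ 2 * P w)
    (hda : ∀ r ∈ Ioo (0 : ℝ) 1, HasDerivAt a (deriv a r) r ∧ 0 < deriv a r)
    {w : ℂ} (hw : w ∈ Metric.ball 0 1) : Function.Injective (fderiv ℝ (sqrtRadialMap P) w) := by
  have hnhds : Metric.ball (0 : ℂ) 1 ∈ 𝓝 w := Metric.isOpen_ball.mem_nhds hw
  have hS : HasFDerivAt (fun w => √(P w)) (fderiv ℝ (fun w => √(P w)) w) w :=
    (((hPs.sqrt fun w hw => (hP w hw).ne').contDiffAt hnhds).differentiableAt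
      (by simp)).hasFDerivAt
  have hN := hS.smul (hasFDerivAt_id w)
  have hNeq : fderiv ℝ (sqrtRadialMap P) w = _ := hN.fderiv
  have hpos := Real.sqrt_pos.2 (hP w hw)
  refine (injective_iff_map_eq_zero _).2 fun v hv => ?_
  have hv' : √(P w) • v + fderiv ℝ (fun w => √(P w)) w v • w = 0 := by
    rw [← hv, hNeq]; simp
  -- `v` is a real multiple of `w`
  obtain ⟨c, rfl⟩ : ∃ c : ℝ, v = c • w := by
    refine ⟨-(fderiv ℝ (fun w => √(P w)) w v / √(P w)), ?_⟩
    have h1 : √(P w) • v = -(fderiv ℝ (fun w => √(P w)) w v • w) := eq_neg_of_add_eq_zero_left hv'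
    rw [neg_smul, div_eq_inv_mul, mul_smul, ← smul_neg, ← h1, inv_smul_smul₀ hpos.ne']
  rcases eq_or_ne w 0 with rfl | hw0
  · simp
  have hw1 := mem_ball_zero_iff.1 hw
  obtain ⟨ha1, ha2⟩ := hda ‖w‖ ⟨norm_pos_iff.2 hw0, hw1⟩
  have hA : HasFDerivAt (fun x : ℂ => a ‖x‖) (deriv a ‖w‖ • ((‖w‖⁻¹ : ℝ) • innerSL ℝ w)) w :=
    ha1.comp_hasFDerivAt w (hasFDerivAt_norm_complex hw0)
  have hNw : HasFDerivAt (sqrtRadialMap P) (fderiv ℝ (sqrtRadialMap P) w) w := by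
    rw [hNeq]; exact hN
  have hB := hNw.norm_sq
  have hAB := hA.unique (hB.congr_of_eventuallyEq (by
    filter_upwards [hnhds] with x hx using (sq_norm_sqrtRadialMap hP ha hx).symm))
  have h1 := congrArg (fun L => L (c • w)) hAB
  have hr : ‖w‖ ≠ 0 := norm_ne_zero_iff.2 hw0
  have e1 : (2 • (innerSL ℝ (sqrtRadialMap P w)).comp (fderiv ℝ (sqrtRadialMap P) w)) (c • w)
      = 0 := by
    rw [smul_apply, ContinuousLinearMap.comp_apply, hv, map_zero, smul_zero]
  rw [e1] at h1
  simp only [smul_apply, innerSL_apply_apply, inner_smul_right, smul_eq_mul,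
    real_inner_self_eq_norm_sq, mul_eq_zero, ha2.ne', inv_eq_zero, hr, false_or, pow_eq_zero_iff,
    or_false, ne_eq, OfNat.ofNat_ne_zero, not_false_eq_true] at h1
  rw [h1, zero_smul]

/-- Both sides lie on the ray through `w`, and their squared norms are `b (ρ r)` and `a r`. -/
theorem sqrtRadialMap_radialMap
    (ha : ∀ w ∈ Metric.ball 0 1, a ‖w‖ = ‖w‖ ^ 2 * P w)
    (hb : ∀ w ∈ Metric.ball 0 1, b ‖w‖ = ‖w‖ ^ 2 * Q w)
    (hρ : ∀ r ∈ Ioo (0 : ℝ) 1, ρ r ∈ Ioo (0 : ℝ) 1 ∧ b (ρ r) = a r)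
    {w : ℂ} (hw : w ∈ Metric.ball 0 1) :
    sqrtRadialMap Q (radialMap ρ w) = sqrtRadialMap P w := by
  rcases eq_or_ne w 0 with rfl | hw0
  · simp [sqrtRadialMap]
  have hr := norm_pos_iff.2 hw0
  obtain ⟨⟨h1, h2⟩, h3⟩ := hρ ‖w‖ ⟨hr, mem_ball_zero_iff.1 hw⟩
  have hn := norm_radialMap hw0 h1.le
  have hQ := hb (radialMap ρ w) (by rwa [mem_ball_zero_iff, hn])
  rw [hn, h3, ha w hw] at hQ
  have hQ' : Q (radialMap ρ w) = (‖w‖ / ρ ‖w‖) ^ 2 * P w := by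
    field_simp
    linarith
  rw [sqrtRadialMap, hQ', Real.sqrt_mul (by positivity), Real.sqrt_sq (by positivity),
    sqrtRadialMap, radialMap, ← Complex.real_smul, smul_smul]
  congr 1
  field_simp

/-- By `sqrtRadialMap_radialMap`, the radial map is `sqrtRadialMap P` followed by the inverse of
`sqrtRadialMap Q`, so no smoothness of `ρ` at the endpoints has to be examined. -/
theorem contDiffOn_radialMap (hPs : ContDiffOn ℝ ∞ P (Metric.ball 0 1))
    (hQs : ContDiffOn ℝ ∞ Q (Metric.ball 0 1))
    (hP : ∀ w ∈ Metric.ball 0 1, 0 < P w) (hQ : ∀ w ∈ Metric.ball 0 1, 0 < Q w)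
    (ha : ∀ w ∈ Metric.ball 0 1, a ‖w‖ = ‖w‖ ^ 2 * P w)
    (hb : ∀ w ∈ Metric.ball 0 1, b ‖w‖ = ‖w‖ ^ 2 * Q w)
    (hdb : ∀ r ∈ Ioo (0 : ℝ) 1, HasDerivAt b (deriv b r) r ∧ 0 < deriv b r)
    (hmono : StrictMonoOn b (Icc 0 1))
    (hρ : ∀ r ∈ Ioo (0 : ℝ) 1, ρ r ∈ Ioo (0 : ℝ) 1 ∧ b (ρ r) = a r) :
    ContDiffOn ℝ ∞ (radialMap ρ) (Metric.ball 0 1) := by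
  intro w hw
  have hmaps : ∀ w ∈ Metric.ball (0 : ℂ) 1, radialMap ρ w ∈ Metric.ball (0 : ℂ) 1 := by
    intro w hw
    rcases eq_or_ne w 0 with rfl | hw0
    · simp
    have h1 := (hρ ‖w‖ ⟨norm_pos_iff.2 hw0, mem_ball_zero_iff.1 hw⟩).1
    rw [mem_ball_zero_iff, norm_radialMap hw0 h1.1.le]
    exact h1.2
  have hnhds : Metric.ball (0 : ℂ) 1 ∈ 𝓝 w := Metric.isOpen_ball.mem_nhds hw
  have hΦ := hmaps w hw
  have hcomm : ∀ w ∈ Metric.ball 0 1, sqrtRadialMap Q (radialMap ρ w) = sqrtRadialMap P w :=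
    fun w hw => sqrtRadialMap_radialMap ha hb hρ hw
  -- A local smooth right inverse suffices: injectivity of `sqrtRadialMap Q` on the whole disc
  -- identifies `g ∘ sqrtRadialMap P` with the radial map.
  obtain ⟨g, hg, hg0, hgr⟩ := ((contDiffOn_sqrtRadialMap hQs hQ).contDiffAt
    (Metric.isOpen_ball.mem_nhds hΦ)).exists_contDiffAt_rightInverse
      (fderiv_sqrtRadialMap_injective hQs hQ hb hdb hΦ)
  rw [hcomm w hw] at hg hg0 hgr
  have hNP : ContDiffAt ℝ ∞ (sqrtRadialMap P) w :=
    (contDiffOn_sqrtRadialMap hPs hP).contDiffAt hnhds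
  have hgball : ∀ᶠ y in 𝓝 (sqrtRadialMap P w), g y ∈ Metric.ball (0 : ℂ) 1 :=
    hg.continuousAt.eventually_mem (Metric.isOpen_ball.mem_nhds (by rwa [hg0]))
  refine ((hg.comp w hNP).congr_of_eventuallyEq ?_).contDiffWithinAt
  filter_upwards [hnhds, hNP.continuousAt.eventually hgr, hNP.continuousAt.eventually hgball]
    with x hx h1 h2
  exact sqrtRadialMap_injOn hQ hb hmono (hmaps x hx) h2 (by rw [hcomm x hx]; exact h1.symm)

end radialMap

/-! ### One-forms on the lens space in the toroidal coordinates. -/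

namespace LensSpace

variable {p q m s : ℤ} {h : m * p + s * q = 1}

theorem contMDiffAt_psiCoord (i : Fin 2) {y : ℂ × ℝ} (hy : ‖y.1‖ < 1) :
    ContMDiffAt 𝓘(ℝ, ℂ × ℝ) 𝓘(ℝ, ℂ × ℝ) ∞ (psiCoord i : ℂ × ℝ → LensSpace p q m s h) y :=
  (contMDiffOn_psiCoord i y hy).contMDiffAt (isOpen_norm_fst_lt.mem_nhds hy)

theorem mdifferentiableAt_psiCoord (i : Fin 2) {y : ℂ × ℝ} (hy : ‖y.1‖ < 1) :
    MDifferentiableAt 𝓘(ℝ, ℂ × ℝ) 𝓘(ℝ, ℂ × ℝ)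
      (psiCoord i : ℂ × ℝ → LensSpace p q m s h) y :=
  (contMDiffAt_psiCoord i hy).mdifferentiableAt (by simp)

theorem psiCoord_of_norm_lt (i : Fin 2) {y : ℂ × ℝ} (hy : ‖y.1‖ < 1) :
    (psiCoord i y : LensSpace p q m s h) =
      psi i (⟨y.1, mem_ball_zero_iff.2 hy⟩, (y.2 : Real.Angle)) :=
  dif_pos _

theorem exists_psiCoord (x : LensSpace p q m s h) :
    ∃ (i : Fin 2) (y : ℂ × ℝ), ‖y.1‖ < 1 ∧ psiCoord i y = x := by
  obtain ⟨i, ⟨w, z⟩, rfl⟩ := exists_psi x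
  induction z using Real.Angle.induction_on with
  | h t =>
    have hw := mem_ball_zero_iff.1 w.2
    exact ⟨i, (w, t), hw, psiCoord_of_norm_lt i hw⟩

/-- Near each of its points, `psiCoord i` has a smooth inverse. -/
theorem exists_contMDiffAt_inverse_psiCoord (i : Fin 2) {y : ℂ × ℝ} (hy : ‖y.1‖ < 1) :
    ∃ g : LensSpace p q m s h → ℂ × ℝ,
      ContMDiffAt 𝓘(ℝ, ℂ × ℝ) 𝓘(ℝ, ℂ × ℝ) ∞ g (psiCoord i y) ∧ g (psiCoord i y) = y ∧
      ∀ᶠ x in 𝓝 (psiCoord i y), psiCoord i (g x) = x := by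
  set e : OpenPartialHomeomorph (LensSpace p q m s h) (ℂ × ℝ) := chart i (y.2 - Real.pi) with he
  have hsymm : ∀ x ∈ e.target, e.symm x = psiCoord i x := by
    intro x hx
    rw [he, chart_target] at hx
    rw [psiCoord_of_norm_lt i hx.1, he]
    exact chart_symm i _ x.1 (mem_ball_zero_iff.2 hx.1) x.2
  have hmem : y ∈ e.target := by
    rw [he, chart_target]
    exact ⟨hy, by linarith [Real.pi_pos], by linarith [Real.pi_pos]⟩
  have hsrc : psiCoord i y ∈ e.source := by
    rw [← hsymm y hmem]
    exact e.map_target hmem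
  refine ⟨e, ?_, ?_, ?_⟩
  · have hmax : e ∈ IsManifold.maximalAtlas 𝓘(ℝ, ℂ × ℝ) ∞ (LensSpace p q m s h) :=
      IsManifold.subset_maximalAtlas ⟨i, _, rfl⟩
    exact (contMDiffOn_of_mem_maximalAtlas hmax).contMDiffAt (e.open_source.mem_nhds hsrc)
  · rw [← hsymm y hmem, e.right_inv hmem]
  · filter_upwards [e.open_source.mem_nhds hsrc] with x hx
    rw [← hsymm _ (e.map_source hx), e.left_inv hx]

theorem mfderiv_psiCoord_surjective (i : Fin 2) {y : ℂ × ℝ} (hy : ‖y.1‖ < 1) :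
    Function.Surjective (mfderiv 𝓘(ℝ, ℂ × ℝ) 𝓘(ℝ, ℂ × ℝ)
      (psiCoord i : ℂ × ℝ → LensSpace p q m s h) y) := by
  obtain ⟨g, hg, hgy, hgr⟩ := exists_contMDiffAt_inverse_psiCoord (h := h) i hy
  have h1 : HasMFDerivAt 𝓘(ℝ, ℂ × ℝ) 𝓘(ℝ, ℂ × ℝ)
      (psiCoord i : ℂ × ℝ → LensSpace p q m s h) (g (psiCoord i y))
      (mfderiv 𝓘(ℝ, ℂ × ℝ) 𝓘(ℝ, ℂ × ℝ)
      (psiCoord i : ℂ × ℝ → LensSpace p q m s h) y) := by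
    rw [hgy]; exact (mdifferentiableAt_psiCoord i hy).hasMFDerivAt
  have h2 := h1.comp _ (hg.mdifferentiableAt (by simp)).hasMFDerivAt
  have h3 := hasMFDerivAt_unique (h2.congr_of_eventuallyEq
    (hgr.mono fun x hx => hx.symm)) (hasMFDerivAt_id _)
  intro v
  exact ⟨_, congrArg (fun L => L v) h3⟩

/-- The coordinate expressions of one-forms are smooth. -/
theorem contDiffOn_coord (α : OneForm p q m s h) (i : Fin 2) :
    ContDiffOn ℝ ∞ (α.coord i) {y | ‖y.1‖ < 1} := by
  -- It suffices to test on constant vectors `v`: the image of `v` under the derivative of `psiCoord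
  -- i` is a smooth map to the tangent bundle, to which `α` is applied.
  refine contDiffOn_clm_apply.2 fun v y hy => ContDiffAt.contDiffWithinAt ?_
  have hy : ‖y.1‖ < 1 := hy
  have hψ := contMDiffAt_psiCoord (h := h) i hy
  have h1 := (α.contMDiff (psiCoord i y)).comp y hψ
  have h2 : ContMDiffAt 𝓘(ℝ, ℂ × ℝ) (𝓘(ℝ, ℂ × ℝ).prod 𝓘(ℝ, ℂ × ℝ)) ∞
      (fun y => Bundle.TotalSpace.mk' (ℂ × ℝ)
        (E := fun x : LensSpace p q m s h => TangentSpace 𝓘(ℝ, ℂ × ℝ) x)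
        (psiCoord i y) (mfderiv 𝓘(ℝ, ℂ × ℝ) 𝓘(ℝ, ℂ × ℝ) (psiCoord i) y v)) y := by
    refine ContMDiffAt.clm_apply_of_inCoordinates (IM := 𝓘(ℝ, ℂ × ℝ)) (IB₁ := 𝓘(ℝ, ℂ × ℝ))
      (IB₂ := 𝓘(ℝ, ℂ × ℝ)) (F₁ := ℂ × ℝ) (F₂ := ℂ × ℝ)
      (E₂ := fun x : LensSpace p q m s h => TangentSpace 𝓘(ℝ, ℂ × ℝ) x)
      (ϕ := fun y => mfderiv 𝓘(ℝ, ℂ × ℝ) 𝓘(ℝ, ℂ × ℝ) (psiCoord i) y)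
      (E₁ := fun x : ℂ × ℝ => TangentSpace 𝓘(ℝ, ℂ × ℝ) x)
      (b₁ := id) (b₂ := psiCoord i) (v := fun _ => v) (hψ.mfderiv_const (by simp)) ?_ hψ
    exact contMDiffAt_vectorSpace_iff_contDiffAt.2 contDiffAt_const
  have h3 := ContMDiffAt.clm_bundle_apply (F₁ := ℂ × ℝ) (F₂ := ℝ)
    (E₁ := fun x : LensSpace p q m s h => TangentSpace 𝓘(ℝ, ℂ × ℝ) x)
    (E₂ := Bundle.Trivial _ ℝ) (b := psiCoord i) h1 h2
  exact (Bundle.contMDiffAt_totalSpace.1 h3).2.contDiffAt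

/-- The pullback of `β` by a map with coordinate expression `f`. -/
theorem apply_mfderiv_eq_coord (β : OneForm p q m s h)
    {Ψ : LensSpace p q m s h → LensSpace p q m s h} {i j : Fin 2} {f : ℂ × ℝ → ℂ × ℝ}
    {f' : (ℂ × ℝ) →L[ℝ] ℂ × ℝ} {y : ℂ × ℝ}
    (hy : ‖y.1‖ < 1) (hfy : ‖(f y).1‖ < 1) (hf : HasFDerivAt f f' y)
    (hΨ : MDifferentiableAt 𝓘(ℝ, ℂ × ℝ) 𝓘(ℝ, ℂ × ℝ) Ψ (psiCoord i y))
    (heq : ∀ᶠ x in 𝓝 y, Ψ (psiCoord i x) = psiCoord j (f x)) (v : ℂ × ℝ) :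
    β (Ψ (psiCoord i y)) (mfderiv 𝓘(ℝ, ℂ × ℝ) 𝓘(ℝ, ℂ × ℝ) Ψ (psiCoord i y)
      (mfderiv 𝓘(ℝ, ℂ × ℝ) 𝓘(ℝ, ℂ × ℝ) (psiCoord i) y v)) = β.coord j (f y) (f' v) := by
  have h1 := hΨ.hasMFDerivAt.comp y (mdifferentiableAt_psiCoord i hy).hasMFDerivAt
  have h2 := (mdifferentiableAt_psiCoord (h := h) j hfy).hasMFDerivAt.comp y hf.hasMFDerivAt
  have h3 := hasMFDerivAt_unique h1 (h2.congr_of_eventuallyEq heq)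
  have h4 := congrArg (fun L : (ℂ × ℝ) →L[ℝ] ℂ × ℝ => L v) h3
  -- Forgetting the dependence of the cotangent fibre on the point allows equal base points to be
  -- substituted.
  let B : LensSpace p q m s h → (ℂ × ℝ) →L[ℝ] ℝ := fun x => β x
  have h5 : B (Ψ (psiCoord i y)) = B (psiCoord j (f y)) := congrArg B heq.self_of_nhds
  exact (congrArg (B (Ψ (psiCoord i y))) h4).trans (congrArg (fun L : (ℂ × ℝ) →L[ℝ] ℝ => L _) h5)

/-- The coordinate change between the two charts near a point off the core, in a local branch `f`,
with `f₁ = R e^{iΘ}`. -/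
theorem exists_transition (p q m s : ℤ) (h : m * p + s * q = 1) {w : ℂ} (hw : w ≠ 0)
    (hw1 : ‖w‖ < 1) (z : ℝ) :
    ∃ (f : ℂ × ℝ → ℂ × ℝ) (f' : (ℂ × ℝ) →L[ℝ] ℂ × ℝ), HasFDerivAt f f' (w, z) ∧
      ‖(f (w, z)).1‖ = 1 - ‖w‖ ∧
      (∀ᶠ x in 𝓝 (w, z), (psiCoord 1 x : LensSpace p q m s h) = psiCoord 0 (f x)) ∧
      ∀ v : ℂ × ℝ, ((f' v).1 / (f (w, z)).1).im = -q * (v.1 / w).im + m * v.2 ∧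
        (f' v).2 = p * (v.1 / w).im + s * v.2 := by
  -- A branch of the argument centred at `w`: the logarithm is only taken near `1`, away from its
  -- cut.
  set θ : ℂ × ℝ → ℝ := fun x => (Complex.log (x.1 / w)).im + Complex.arg w with hθ
  set f : ℂ × ℝ → ℂ × ℝ := fun x =>
    (((1 - ‖x.1‖ : ℝ) : ℂ) * Complex.exp (((-q) * θ x + m * x.2 : ℝ) * Complex.I),
      p * θ x + s * x.2) with hf
  have hθd : HasFDerivAt θ (Complex.imCLM.comp ((w⁻¹ • (1 : ℂ →L[ℝ] ℂ)).comp
      (ContinuousLinearMap.fst ℝ ℂ ℝ))) (w, z) := by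
    have h1 : HasDerivAt (fun x : ℂ => Complex.log (x / w)) w⁻¹ w := by
      have h2 : HasDerivAt (fun x : ℂ => x / w) (1 / w) w := (hasDerivAt_id w).div_const w
      have h3 := h2.clog (by rw [div_self hw]; exact Complex.one_mem_slitPlane)
      exact h3.congr_deriv (by rw [div_self hw, div_one, one_div])
    exact (Complex.imCLM.hasFDerivAt.comp (w, z) (h1.complexToReal_fderiv.comp (w, z)
      (hasFDerivAt_fst (𝕜 := ℝ) (E := ℂ) (F := ℝ)))).add_const _
  have hθa : ∀ᶠ x : ℂ × ℝ in 𝓝 (w, z), (Complex.arg x.1 : Real.Angle) = (θ x : ℝ) := by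
    have : ∀ᶠ x : ℂ × ℝ in 𝓝 (w, z), x.1 ≠ 0 := continuousAt_fst.eventually_ne hw
    filter_upwards [this] with x hx
    simp only [hθ]
    rw [Complex.log_im, Real.Angle.coe_add, ← Complex.arg_mul_coe_angle (div_ne_zero hx hw) hw,
      div_mul_cancel₀ _ hw]
  have hn : HasFDerivAt (fun x : ℂ × ℝ => ‖x.1‖) (((‖w‖⁻¹ : ℝ) • innerSL ℝ w).comp
      (ContinuousLinearMap.fst ℝ ℂ ℝ)) (w, z) :=
    (hasFDerivAt_norm_complex hw).comp (w, z) (hasFDerivAt_fst (𝕜 := ℝ) (E := ℂ) (F := ℝ))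
  have hR : HasFDerivAt (fun x : ℂ × ℝ => ((1 - ‖x.1‖ : ℝ) : ℂ)) _ (w, z) :=
    Complex.ofRealCLM.hasFDerivAt.comp (w, z) (hn.const_sub 1)
  have hsnd := hasFDerivAt_snd (𝕜 := ℝ) (E := ℂ) (F := ℝ) (p := (w, z))
  have hΘ : HasFDerivAt (fun x : ℂ × ℝ => (((-q) * θ x + m * x.2 : ℝ) : ℂ)) _ (w, z) :=
    Complex.ofRealCLM.hasFDerivAt.comp (w, z)
      ((hθd.const_mul (-q : ℝ)).add (hsnd.const_mul (m : ℝ)))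
  have hfd := (hR.mul (hΘ.mul_const Complex.I).cexp).prodMk
    ((hθd.const_mul (p : ℝ)).add (hsnd.const_mul (s : ℝ)))
  have hlt : (0 : ℝ) < 1 - ‖w‖ := by linarith
  have hnorm : ∀ x : ℂ × ℝ, ‖x.1‖ < 1 → ‖(f x).1‖ = 1 - ‖x.1‖ := fun x hx => by
    simp only [hf]
    rw [norm_mul, Complex.norm_exp_ofReal_mul_I, mul_one, Complex.norm_real,
      Real.norm_of_nonneg (by linarith)]
  refine ⟨f, _, hfd, hnorm _ hw1, ?_, ?_⟩
  · have h0 : ∀ᶠ x : ℂ × ℝ in 𝓝 (w, z), x.1 ≠ 0 := continuousAt_fst.eventually_ne hw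
    have h1 : {y : ℂ × ℝ | ‖y.1‖ < 1} ∈ 𝓝 (w, z) := isOpen_norm_fst_lt.mem_nhds hw1
    filter_upwards [h0, h1, hθa] with x hx hx1 hxθ
    have hfx : ‖(f x).1‖ < 1 := by
      rw [hnorm x hx1]; linarith [norm_pos_iff.2 hx]
    rw [psiCoord_of_norm_lt 1 hx1, psiCoord_of_norm_lt 0 hfx, eq_comm, psi_zero_eq_psi_one]
    refine ⟨hx, ?_⟩
    have e1 : (-q) • ((θ x : ℝ) : Real.Angle) + m • (x.2 : Real.Angle) =
        ((-q * θ x + m * x.2 : ℝ) : Real.Angle) := by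
      rw [← Real.Angle.coe_zsmul, ← Real.Angle.coe_zsmul, ← Real.Angle.coe_add]
      simp
    have e2 : p • ((θ x : ℝ) : Real.Angle) + s • (x.2 : Real.Angle) =
        ((p * θ x + s * x.2 : ℝ) : Real.Angle) := by
      rw [← Real.Angle.coe_zsmul, ← Real.Angle.coe_zsmul, ← Real.Angle.coe_add]
      simp
    simp only [SolidTorus.val, lensTransition, hxθ, e1, e2, Real.Angle.toCircle_coe,
      Circle.coe_exp, hf]
  · intro v
    have hE := Complex.exp_ne_zero (((-q * θ (w, z) + m * z : ℝ) : ℂ) * Complex.I)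
    have hRne : ((1 - ‖w‖ : ℝ) : ℂ) ≠ 0 := Complex.ofReal_ne_zero.2 hlt.ne'
    constructor
    · simp only [hf, ContinuousLinearMap.prod_apply]
      set E := Complex.exp (((-q * θ (w, z) + m * z : ℝ) : ℂ) * Complex.I)
      set A : ℝ := -q * (w⁻¹ * v.1).im + m * v.2
      set B : ℝ := -(‖w‖⁻¹ * inner ℝ w v.1)
      change ((((1 - ‖w‖ : ℝ) : ℂ) * (E * (Complex.I * (A : ℂ))) + E * (B : ℂ)) /
        (((1 - ‖w‖ : ℝ) : ℂ) * E)).im = _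
      -- The logarithmic derivative of `R e^{iΘ}` is `dR / R + i dΘ`; here `B` and `A` are the
      -- values of `dR` and `dΘ` on `v`.
      have e : (((1 - ‖w‖ : ℝ) : ℂ) * (E * (Complex.I * (A : ℂ))) + E * (B : ℂ)) /
          (((1 - ‖w‖ : ℝ) : ℂ) * E) = ((B / (1 - ‖w‖) : ℝ) : ℂ) + (A : ℂ) * Complex.I := by
        rw [Complex.ofReal_div]
        field_simp
        ring
      rw [e, Complex.add_im, Complex.ofReal_im, Complex.im_ofReal_mul, Complex.I_im, mul_one, zero_add,
        div_eq_inv_mul]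
    · simp [div_eq_inv_mul]

/-! ### Associated forms in the second chart and their boundary values. -/

/-- The coordinate expression in the second chart of a one-form associated with a triple. -/
theorem OneForm.IsAssociated.coord_one {α : OneForm p q m s h} {a : ℝ → ℝ} {τ₀ φ₀ : ℝ}
    (hα : α.IsAssociated a τ₀ φ₀) {w : ℂ} (hw : w ≠ 0) (hw1 : ‖w‖ < 1) (z : ℝ) (v : ℂ) (t : ℝ) :
    α.coord 1 (w, z) (v, t) =
      (τ₀ / (2 * Real.pi) - φ₀ * a (1 - ‖w‖)) * (p * (v / w).im + s * t) +
        a (1 - ‖w‖) * (-q * (v / w).im + m * t) := by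
  obtain ⟨f, f', hf, hn, heq, hf'⟩ := exists_transition p q m s h hw hw1 z
  have hr := norm_pos_iff.2 hw
  have hfy : ‖(f (w, z)).1‖ < 1 := by rw [hn]; linarith
  -- The change of charts is the coordinate expression of the identity map.
  have h1 := apply_mfderiv_eq_coord α (Ψ := id) (i := 1) (j := 0) (y := (w, z)) hw1 hfy hf
    mdifferentiableAt_id heq (v, t)
  rw [mfderiv_id] at h1
  have h2 := hα (f (w, z)).1 (f (w, z)).2 (norm_pos_iff.1 (by rw [hn]; linarith)) hfy
    (f' (v, t)).1 (f' (v, t)).2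
  have h3 : α.coord 1 (w, z) (v, t) = α.coord 0 (f (w, z)) (f' (v, t)) := h1
  rw [h3]
  refine h2.trans ?_
  rw [(hf' (v, t)).1, (hf' (v, t)).2, hn]

/-- The radial coefficient of `dθ` in the `i`-th chart. -/
def radialCoeff (p q : ℤ) (T φ : ℝ) (a : ℝ → ℝ) : Fin 2 → ℝ → ℝ :=
  ![a, fun r => p * T - (q + p * φ) * a (1 - r)]

theorem continuousOn_radialCoeff {T φ : ℝ} {a : ℝ → ℝ} (ha : ContinuousOn a (Icc 0 1))
    (i : Fin 2) : ContinuousOn (radialCoeff p q T φ a i) (Icc 0 1) := by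
  fin_cases i
  · exact ha
  · refine continuousOn_const.sub (continuousOn_const.mul (ha.comp (by fun_prop) ?_))
    exact fun r hr => ⟨by linarith [hr.2], by linarith [hr.1]⟩

section coeff

variable {α : OneForm p q m s h} {a : ℝ → ℝ} {τ₀ φ₀ : ℝ}

/-- This is the vanishing of the `dθ`-coefficient on the second core, which lies at `r = 1` in the
first radius. Its right side does not involve `a`. -/
theorem coeff_one (hα : α.IsAssociated a τ₀ φ₀) (ha : ContinuousOn a (Icc 0 1)) :
    (q + p * φ₀) * a 1 = p * (τ₀ / (2 * Real.pi)) := by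
  have hc := continuousOn_radialCoeff (p := p) (q := q) (T := τ₀ / (2 * Real.pi)) (φ := φ₀) ha 1
  have h0 := eq_zero_of_apply_I_mul (fun w hw hw1 => ?_) (contDiffOn_coord α 1) hc
  · simp only [radialCoeff, Matrix.cons_val_one, Matrix.cons_val_fin_one, sub_zero] at h0
    linarith
  · rw [hα.coord_one hw hw1, mul_div_assoc, div_self hw]
    simp [radialCoeff]
    ring

theorem coeff_strictMonoOn (hτ : 0 < τ₀) (hpos : α.IsPositiveContact)
    (hα : α.IsAssociated a τ₀ φ₀) (ha : ContinuousOn a (Icc 0 1)) : StrictMonoOn a (Icc 0 1) :=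
  IsRadialForm.strictMonoOn hα (contDiffOn_coord α 0) (by positivity) (hpos 0) ha

theorem coeff_zero (hα : α.IsAssociated a τ₀ φ₀) (ha : ContinuousOn a (Icc 0 1)) : a 0 = 0 :=
  IsRadialForm.eq_zero hα (contDiffOn_coord α 0) ha

/-- Monotonicity gives `a 1 > a 0 = 0`, while the product `(q + pφ₀) a 1 = pT` is positive. -/
theorem add_mul_pos (hp : 0 < p) (hτ : 0 < τ₀) (hpos : α.IsPositiveContact)
    (hα : α.IsAssociated a τ₀ φ₀) (ha : ContinuousOn a (Icc 0 1)) : 0 < q + p * φ₀ := by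
  have h1 := coeff_strictMonoOn hτ hpos hα ha (by simp : (0 : ℝ) ∈ Icc 0 1)
    (by simp : (1 : ℝ) ∈ Icc 0 1) zero_lt_one
  rw [coeff_zero hα ha] at h1
  have h2 := coeff_one hα ha
  have hp' : (0 : ℝ) < p := by exact_mod_cast hp
  have h3 : 0 < (q + p * φ₀) * a 1 := by rw [h2]; positivity
  exact pos_of_mul_pos_left h3 h1.le

/-- In both charts, the coordinate expression of an associated form is radial, with constants that
depend on the form only through `τ₀` and `φ₀`. -/
theorem exists_isRadialForm_coord (h : m * p + s * q = 1) (hτ : 0 < τ₀) (hφ : 0 < q + p * φ₀)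
    (i : Fin 2) :
    ∃ T φ : ℝ, 0 < T ∧ ∀ (α : OneForm p q m s h) (a : ℝ → ℝ), α.IsAssociated a τ₀ φ₀ →
      IsRadialForm (α.coord i) (radialCoeff p q (τ₀ / (2 * Real.pi)) φ₀ a i) T φ := by
  fin_cases i
  · exact ⟨τ₀ / (2 * Real.pi), φ₀, by positivity, fun α a hα => hα⟩
  -- The constants come from eliminating `a` between the `dz`-coefficient `sT + (m - sφ₀) a` and the
  -- `dθ`-coefficient `pT - (q + pφ₀) a`; `mp + sq = 1` simplifies the constant term.
  · refine ⟨τ₀ / (2 * Real.pi) / (q + p * φ₀), (m - s * φ₀) / (q + p * φ₀), by positivity,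
      fun α a hα w z hw hw1 v t => ?_⟩
    refine (hα.coord_one hw hw1 z v t).trans ?_
    have h' : (m * p + s * q : ℝ) = 1 := by exact_mod_cast h
    generalize τ₀ / (2 * Real.pi) = T
    simp only [radialCoeff, Fin.mk_one, Matrix.cons_val_one, Matrix.cons_val_fin_one]
    have h2 : T / (q + p * φ₀) = s * T + (m - s * φ₀) / (q + p * φ₀) * (p * T) := by
      field_simp
      linear_combination -T * h'
    have h3 : (m - s * φ₀) = (m - s * φ₀) / (q + p * φ₀) * (q + p * φ₀) :=
      (div_mul_cancel₀ _ hφ.ne').symm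
    rw [h2]
    linear_combination a (1 - ‖w‖) * t * h3

end coeff

end LensSpace

/-! ### Radial maps of the disc and pullback of radial forms. -/

theorem radialMap_mem_ball {ρ : ℝ → ℝ} (hρ : MapsTo ρ (Ioo 0 1) (Ioo 0 1)) {w : ℂ}
    (hw : w ∈ Metric.ball (0 : ℂ) 1) : radialMap ρ w ∈ Metric.ball (0 : ℂ) 1 := by
  rcases eq_or_ne w 0 with rfl | hw0
  · simp
  have h1 := hρ ⟨norm_pos_iff.2 hw0, mem_ball_zero_iff.1 hw⟩
  rw [mem_ball_zero_iff, norm_radialMap hw0 h1.1.le]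
  exact h1.2

theorem radialMap_ne_zero {ρ : ℝ → ℝ} (hρ : MapsTo ρ (Ioo 0 1) (Ioo 0 1)) {w : ℂ} (hw : w ≠ 0)
    (hw1 : ‖w‖ < 1) : radialMap ρ w ≠ 0 := by
  have h1 := hρ ⟨norm_pos_iff.2 hw, hw1⟩
  rw [← norm_pos_iff, norm_radialMap hw h1.1.le]
  exact h1.1

theorem arg_radialMap {ρ : ℝ → ℝ} (hρ : MapsTo ρ (Ioo 0 1) (Ioo 0 1)) {w : ℂ} (hw : w ≠ 0)
    (hw1 : ‖w‖ < 1) : Complex.arg (radialMap ρ w) = Complex.arg w :=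
  Complex.arg_real_mul _ (div_pos (hρ ⟨norm_pos_iff.2 hw, hw1⟩).1 (norm_pos_iff.2 hw))

theorem radialMap_radialMap {ρ σ : ℝ → ℝ} (hρ : MapsTo ρ (Ioo 0 1) (Ioo 0 1))
    (hσ : ∀ r ∈ Ioo (0 : ℝ) 1, σ (ρ r) = r) {w : ℂ} (hw1 : ‖w‖ < 1) :
    radialMap σ (radialMap ρ w) = w := by
  rcases eq_or_ne w 0 with rfl | hw
  · simp
  have hr : ‖w‖ ∈ Ioo (0 : ℝ) 1 := ⟨norm_pos_iff.2 hw, hw1⟩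
  have h1 := (hρ hr).1
  have h2 := hr.1
  rw [radialMap, norm_radialMap hw h1.le, hσ _ hr, radialMap, ← mul_assoc, ← Complex.ofReal_mul]
  have : ‖w‖ / ρ ‖w‖ * (ρ ‖w‖ / ‖w‖) = 1 := by field_simp
  rw [this, Complex.ofReal_one, one_mul]

/-- The derivative of a radial map preserves `dθ`. -/
theorem im_div_radialMap {ρ : ℝ → ℝ} (hρ : MapsTo ρ (Ioo 0 1) (Ioo 0 1)) {w : ℂ} (hw : w ≠ 0)
    (hw1 : ‖w‖ < 1) {f' : ℂ →L[ℝ] ℂ} (hf : HasFDerivAt (radialMap ρ) f' w) (v : ℂ) :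
    (f' v / radialMap ρ w).im = (v / w).im := by
  have hk : 0 < ρ ‖w‖ / ‖w‖ := div_pos (hρ ⟨norm_pos_iff.2 hw, hw1⟩).1 (norm_pos_iff.2 hw)
  have hinv : HasFDerivAt (fun x : ℂ => x⁻¹) ((-(w ^ 2)⁻¹) • (1 : ℂ →L[ℝ] ℂ)) w :=
    (hasDerivAt_inv hw).complexToReal_fderiv
  -- The quotient of `radialMap ρ x` by `x` is real, so the derivative of its imaginary part
  -- vanishes.
  have h1 := Complex.imCLM.hasFDerivAt.comp w (hf.mul hinv)
  have h2 : HasFDerivAt (fun _ : ℂ => (0 : ℝ)) (0 : ℂ →L[ℝ] ℝ) w := hasFDerivAt_const _ _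
  have h3 := h1.unique (h2.congr_of_eventuallyEq (by
    filter_upwards [continuousAt_id.eventually_ne hw] with x hx
    have hx : x ≠ 0 := hx
    simp [radialMap, mul_assoc, mul_inv_cancel₀ hx, -Complex.ofReal_div]))
  have h4 : (radialMap ρ w * (-(w ^ 2)⁻¹ * v) + w⁻¹ * f' v).im = 0 :=
    congrArg (fun L : ℂ →L[ℝ] ℝ => L v) h3
  set k : ℝ := ρ ‖w‖ / ‖w‖ with hkd
  have hR : radialMap ρ w = (k : ℂ) * w := rfl
  have hkC : (k : ℂ) ≠ 0 := Complex.ofReal_ne_zero.2 hk.ne'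
  have e1 : f' v / radialMap ρ w - v / w =
      ((k⁻¹ : ℝ) : ℂ) * (radialMap ρ w * (-(w ^ 2)⁻¹ * v) + w⁻¹ * f' v) := by
    rw [hR, Complex.ofReal_inv]
    field_simp
    ring
  have e2 := congrArg Complex.im e1
  rw [Complex.im_ofReal_mul, h4, mul_zero, Complex.sub_im] at e2
  linarith

/-- Off the core this is `b ∘ ρ = a` together with invariance of `dθ` and `dz`. Both sides are
continuous, so density of the complement of the core gives the identity on the core too. -/
theorem IsRadialForm.comp_radialMap {η ζ : ℂ × ℝ → (ℂ × ℝ) →L[ℝ] ℝ} {a b ρ : ℝ → ℝ} {T φ : ℝ}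
    (hη : IsRadialForm η a T φ) (hζ : IsRadialForm ζ b T φ)
    (hηs : ContDiffOn ℝ ∞ η {y | ‖y.1‖ < 1}) (hζs : ContDiffOn ℝ ∞ ζ {y | ‖y.1‖ < 1})
    (hρ : MapsTo ρ (Ioo 0 1) (Ioo 0 1)) (hab : ∀ r ∈ Ioo (0 : ℝ) 1, b (ρ r) = a r)
    (hs : ContDiffOn ℝ ∞ (radialMap ρ) (Metric.ball 0 1)) {y : ℂ × ℝ} (hy : ‖y.1‖ < 1)
    (u : ℂ × ℝ) :
    ζ (radialMap ρ y.1, y.2) (fderiv ℝ (radialMap ρ) y.1 u.1, u.2) = η y u := by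
  have hopen := isOpen_norm_fst_lt
  have hfst : MapsTo Prod.fst {y : ℂ × ℝ | ‖y.1‖ < 1} (Metric.ball (0 : ℂ) 1) :=
    fun y hy => mem_ball_zero_iff.2 hy
  have hc1 : ContinuousOn (fun y : ℂ × ℝ => ζ (radialMap ρ y.1, y.2)) {y | ‖y.1‖ < 1} :=
    hζs.continuousOn.comp
      ((hs.continuousOn.comp continuousOn_fst hfst).prodMk continuousOn_snd)
      (fun y hy => mem_ball_zero_iff.1 (radialMap_mem_ball hρ (hfst hy)))
  have hc2 : ContinuousOn (fun y : ℂ × ℝ => (fderiv ℝ (radialMap ρ) y.1 u.1, u.2))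
      {y | ‖y.1‖ < 1} :=
    ((((hs.fderiv_of_isOpen (m := ∞) Metric.isOpen_ball (by simp)).continuousOn.comp
      continuousOn_fst hfst).clm_apply continuousOn_const)).prodMk continuousOn_const
  have hdense : Dense {y : ℂ × ℝ | y.1 ≠ 0} := by
    have := (dense_compl_singleton (0 : ℂ)).prod (dense_univ (X := ℝ))
    convert this using 1
    ext; simp
  refine EqOn.of_subset_closure (s := {y : ℂ × ℝ | ‖y.1‖ < 1} ∩ {y | y.1 ≠ 0}) ?_
    (hc1.clm_apply hc2) (hηs.continuousOn.clm_apply continuousOn_const) inter_subset_left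
    (hdense.open_subset_closure_inter hopen) hy
  rintro ⟨w, z⟩ ⟨hw1, hw⟩
  have hw1 : ‖w‖ < 1 := hw1
  have hr := hρ ⟨norm_pos_iff.2 hw, hw1⟩
  have hd : HasFDerivAt (radialMap ρ) (fderiv ℝ (radialMap ρ) w) w :=
    ((hs.contDiffAt (Metric.isOpen_ball.mem_nhds
      (mem_ball_zero_iff.2 hw1))).differentiableAt (by simp)).hasFDerivAt
  have hn := norm_radialMap hw hr.1.le
  have h1 := hζ (radialMap ρ w) z (radialMap_ne_zero hρ hw hw1)
    (mem_ball_zero_iff.1 (radialMap_mem_ball hρ (mem_ball_zero_iff.2 hw1)))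
    (fderiv ℝ (radialMap ρ) w u.1) u.2
  rw [hn, hab _ ⟨norm_pos_iff.2 hw, hw1⟩, im_div_radialMap hρ hw hw1 hd] at h1
  exact h1.trans (hη w z hw hw1 u.1 u.2).symm

/-- The map `(r e^{iθ}, z) ↦ (ρ(r) e^{iθ}, z)` of the open solid torus. -/
def SolidTorus.radialMap (ρ : ℝ → ℝ) (hρ : MapsTo ρ (Ioo 0 1) (Ioo 0 1)) (u : SolidTorus) :
    SolidTorus :=
  (⟨_root_.radialMap ρ u.1, radialMap_mem_ball hρ u.1.2⟩, u.2)

/-! ### The radial diffeomorphism of the lens space. -/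

namespace LensSpace

variable {p q m s : ℤ} {h : m * p + s * q = 1}

/-- The reparametrization `ρ` of the radius, read in the `i`-th chart. -/
def chartRadius (ρ : ℝ → ℝ) : Fin 2 → ℝ → ℝ := ![ρ, fun r => 1 - ρ (1 - r)]

theorem mapsTo_chartRadius {ρ : ℝ → ℝ} (hρ : MapsTo ρ (Ioo 0 1) (Ioo 0 1)) (i : Fin 2) :
    MapsTo (chartRadius ρ i) (Ioo 0 1) (Ioo 0 1) := by
  fin_cases i
  · exact hρ
  · intro r hr
    have := hρ (show 1 - r ∈ Ioo (0 : ℝ) 1 from ⟨by linarith [hr.2], by linarith [hr.1]⟩)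
    exact ⟨by simpa [chartRadius] using this.2, by simpa [chartRadius] using this.1⟩

theorem chartRadius_chartRadius {ρ σ : ℝ → ℝ} (hσ : ∀ r ∈ Ioo (0 : ℝ) 1, σ (ρ r) = r)
    (i : Fin 2) : ∀ r ∈ Ioo (0 : ℝ) 1, chartRadius σ i (chartRadius ρ i r) = r := by
  fin_cases i
  · exact hσ
  · intro r hr
    have := hσ (1 - r) ⟨by linarith [hr.2], by linarith [hr.1]⟩
    simp [chartRadius, this]

/-- The gluing map sends `r` to `1 - r` and treats the angles independently of `r`, so it conjugates
one radial map into the other. This compatibility makes `radialReparam` well defined. -/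
theorem lensTransition_radialMap {ρ : ℝ → ℝ} (hρ : MapsTo ρ (Ioo 0 1) (Ioo 0 1)) {w : ℂ}
    (hw : w ≠ 0) (hw1 : ‖w‖ < 1) (z : Real.Angle) :
    lensTransition p q m s (radialMap (chartRadius ρ 1) w, z) =
      (radialMap ρ (lensTransition p q m s (w, z)).1, (lensTransition p q m s (w, z)).2) := by
  have hρ1 := mapsTo_chartRadius hρ 1
  have hn := norm_radialMap hw (hρ1 ⟨norm_pos_iff.2 hw, hw1⟩).1.le
  have hl := norm_lensTransition (p := p) (q := q) (m := m) (s := s) (x := (w, z)) hw1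
  ext1
  · have hR : (radialMap ρ (lensTransition p q m s (w, z)).1, (lensTransition p q m s (w, z)).2).1 =
        ((ρ (1 - ‖w‖) / (1 - ‖w‖) : ℝ) : ℂ) * (lensTransition p q m s (w, z)).1 := by
      simp only [radialMap, hl]
    rw [hR]
    simp only [lensTransition, arg_radialMap hρ1 hw hw1, hn]
    rw [← mul_assoc, ← Complex.ofReal_mul, div_mul_cancel₀ _ (by linarith)]
    simp [chartRadius]
  · simp only [lensTransition, arg_radialMap hρ1 hw hw1]

/-- The radial reparametrization of `L(p, q)`: it is `r ↦ ρ(r)` in the first chart and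
`r ↦ 1 - ρ(1 - r)` in the second one. -/
def radialReparam (ρ : ℝ → ℝ) (hρ : MapsTo ρ (Ioo 0 1) (Ioo 0 1)) :
    LensSpace p q m s h → LensSpace p q m s h :=
  Quotient.map (Sum.map (SolidTorus.radialMap (chartRadius ρ 0) (mapsTo_chartRadius hρ 0))
    (SolidTorus.radialMap (chartRadius ρ 1) (mapsTo_chartRadius hρ 1))) (by
    have key : ∀ u v : SolidTorus, ((v.1 : ℂ) ≠ 0 ∧ u.val = lensTransition p q m s v.val) →
        (((SolidTorus.radialMap (chartRadius ρ 1) (mapsTo_chartRadius hρ 1) v).1 : ℂ) ≠ 0 ∧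
        (SolidTorus.radialMap (chartRadius ρ 0) (mapsTo_chartRadius hρ 0) u).val =
        lensTransition p q m s
          (SolidTorus.radialMap (chartRadius ρ 1) (mapsTo_chartRadius hρ 1) v).val) := by
      rintro u v ⟨hv, huv⟩
      have hv1 : ‖(v.1 : ℂ)‖ < 1 := v.norm_val_lt
      refine ⟨radialMap_ne_zero (mapsTo_chartRadius hρ 1) hv hv1, ?_⟩
      refine Eq.trans ?_ (lensTransition_radialMap hρ hv hv1 v.2).symm
      change (radialMap ρ u.val.1, u.val.2) = _
      rw [huv]
      rfl
    rintro (u | u) (v | v) huv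
    · exact congrArg _ huv
    · exact key u v huv
    · exact key v u huv
    · exact congrArg _ huv)

theorem radialReparam_psiCoord {ρ : ℝ → ℝ} (hρ : MapsTo ρ (Ioo 0 1) (Ioo 0 1)) (i : Fin 2)
    {y : ℂ × ℝ} (hy : ‖y.1‖ < 1) :
    radialReparam ρ hρ (psiCoord i y : LensSpace p q m s h) =
      psiCoord i (radialMap (chartRadius ρ i) y.1, y.2) := by
  have hb := radialMap_mem_ball (mapsTo_chartRadius hρ i) (mem_ball_zero_iff.2 hy)
  rw [psiCoord_of_norm_lt i hy, psiCoord_of_norm_lt i (mem_ball_zero_iff.1 hb)]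
  fin_cases i <;> rfl

theorem radialReparam_radialReparam {ρ σ : ℝ → ℝ} (hρ : MapsTo ρ (Ioo 0 1) (Ioo 0 1))
    (hσ : MapsTo σ (Ioo 0 1) (Ioo 0 1)) (hσρ : ∀ r ∈ Ioo (0 : ℝ) 1, σ (ρ r) = r)
    (x : LensSpace p q m s h) : radialReparam σ hσ (radialReparam ρ hρ x) = x := by
  obtain ⟨i, y, hy, rfl⟩ := exists_psiCoord x
  rw [radialReparam_psiCoord hρ i hy, radialReparam_psiCoord hσ i
    (mem_ball_zero_iff.1 (radialMap_mem_ball (mapsTo_chartRadius hρ i) (mem_ball_zero_iff.2 hy))),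
    radialMap_radialMap (mapsTo_chartRadius hρ i) (chartRadius_chartRadius hσρ i) hy]

theorem contMDiff_radialReparam {ρ : ℝ → ℝ} (hρ : MapsTo ρ (Ioo 0 1) (Ioo 0 1))
    (hs : ∀ i, ContDiffOn ℝ ∞ (radialMap (chartRadius ρ i)) (Metric.ball 0 1)) :
    ContMDiff 𝓘(ℝ, ℂ × ℝ) 𝓘(ℝ, ℂ × ℝ) ∞
      (radialReparam ρ hρ : LensSpace p q m s h → LensSpace p q m s h) := by
  intro x
  obtain ⟨i, y, hy, rfl⟩ := exists_psiCoord x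
  obtain ⟨g, hg, hgy, hgr⟩ := exists_contMDiffAt_inverse_psiCoord (h := h) i hy
  have hb := radialMap_mem_ball (mapsTo_chartRadius hρ i) (mem_ball_zero_iff.2 hy)
  have hf : ContDiffAt ℝ ∞ (fun y : ℂ × ℝ => (radialMap (chartRadius ρ i) y.1, y.2)) y :=
    (((hs i).contDiffAt (Metric.isOpen_ball.mem_nhds (mem_ball_zero_iff.2 hy))).comp y
      contDiffAt_fst).prodMk contDiffAt_snd
  have h1 := (contMDiffAt_psiCoord (h := h) i
    (y := (radialMap (chartRadius ρ i) y.1, y.2)) (mem_ball_zero_iff.1 hb)).comp y hf.contMDiffAt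
  have h2 := ContMDiffAt.comp_of_eq h1 hg hgy
  refine h2.congr_of_eventuallyEq ?_
  have hball : ∀ᶠ x in 𝓝 (psiCoord i y : LensSpace p q m s h), ‖(g x).1‖ < 1 :=
    hg.continuousAt.eventually_mem (isOpen_norm_fst_lt.mem_nhds (by rw [hgy]; exact hy))
  filter_upwards [hgr, hball] with x hx hx1
  conv_lhs => rw [← hx]
  exact radialReparam_psiCoord hρ i hx1

theorem isPullback_radialReparam {α β : OneForm p q m s h} {a b : Fin 2 → ℝ → ℝ}
    {T φ : Fin 2 → ℝ} (hα : ∀ i, IsRadialForm (α.coord i) (a i) (T i) (φ i))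
    (hβ : ∀ i, IsRadialForm (β.coord i) (b i) (T i) (φ i))
    {ρ : ℝ → ℝ} (hρ : MapsTo ρ (Ioo 0 1) (Ioo 0 1))
    (hab : ∀ i, ∀ r ∈ Ioo (0 : ℝ) 1, b i (chartRadius ρ i r) = a i r)
    (hs : ∀ i, ContDiffOn ℝ ∞ (radialMap (chartRadius ρ i)) (Metric.ball 0 1)) :
    IsPullback (radialReparam ρ hρ) β α := by
  intro x
  obtain ⟨i, y, hy, rfl⟩ := exists_psiCoord x
  have hb := radialMap_mem_ball (mapsTo_chartRadius hρ i) (mem_ball_zero_iff.2 hy)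
  have hd : HasFDerivAt (radialMap (chartRadius ρ i))
      (fderiv ℝ (radialMap (chartRadius ρ i)) y.1) y.1 :=
    (((hs i).contDiffAt (Metric.isOpen_ball.mem_nhds
      (mem_ball_zero_iff.2 hy))).differentiableAt (by simp)).hasFDerivAt
  have hf := (hd.comp y (hasFDerivAt_fst (𝕜 := ℝ))).prodMk (hasFDerivAt_snd (𝕜 := ℝ) (p := y))
  refine ContinuousLinearMap.ext fun u => ?_
  -- Every tangent vector comes from the coordinates, so the identity may be checked on coordinate
  -- expressions.
  obtain ⟨v, rfl⟩ := mfderiv_psiCoord_surjective (h := h) i hy u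
  have h1 := apply_mfderiv_eq_coord β (Ψ := radialReparam ρ hρ) (i := i) (j := i) (y := y) hy
    (mem_ball_zero_iff.1 hb) hf
    ((contMDiff_radialReparam hρ hs).mdifferentiable (by simp) _) (by
      filter_upwards [isOpen_norm_fst_lt.mem_nhds hy] with x hx
      exact radialReparam_psiCoord hρ i hx) v
  exact h1.trans ((hα i).comp_radialMap (hβ i) (contDiffOn_coord α i) (contDiffOn_coord β i)
    (mapsTo_chartRadius hρ i) (hab i) (hs i) hy v)

/-- If `b ∘ ρ = a`, then `ρ` reparametrizes the coordinates smoothly in both charts. -/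
theorem contDiffOn_radialMap_chartRadius {α β : OneForm p q m s h} {a b : ℝ → ℝ} {τ₀ φ₀ : ℝ}
    (hτ : 0 < τ₀) (hφ : 0 < q + p * φ₀)
    (ha : ContinuousOn a (Icc 0 1)) (hb : ContinuousOn b (Icc 0 1))
    (hα : α.IsPositiveContact) (hβ : β.IsPositiveContact)
    (hαa : α.IsAssociated a τ₀ φ₀) (hβb : β.IsAssociated b τ₀ φ₀)
    {ρ : ℝ → ℝ} (hρ : MapsTo ρ (Ioo 0 1) (Ioo 0 1))
    (hab : ∀ i, ∀ r ∈ Ioo (0 : ℝ) 1,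
      radialCoeff p q (τ₀ / (2 * Real.pi)) φ₀ b i (chartRadius ρ i r) =
        radialCoeff p q (τ₀ / (2 * Real.pi)) φ₀ a i r) (i : Fin 2) :
    ContDiffOn ℝ ∞ (radialMap (chartRadius ρ i)) (Metric.ball 0 1) := by
  obtain ⟨T, φ, hT, hrad⟩ := exists_isRadialForm_coord h hτ hφ i
  have hra := hrad α a hαa
  have hrb := hrad β b hβb
  have hca := continuousOn_radialCoeff (p := p) (q := q) (T := τ₀ / (2 * Real.pi)) (φ := φ₀) ha i
  have hcb := continuousOn_radialCoeff (p := p) (q := q) (T := τ₀ / (2 * Real.pi)) (φ := φ₀) hb i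
  have hsa := contDiffOn_coord α i
  have hsb := contDiffOn_coord β i
  obtain ⟨P, hPs, hP, haP⟩ := hra.exists_eq_norm_sq_mul hsa hT (hα i) hca
  obtain ⟨Q, hQs, hQ, hbQ⟩ := hrb.exists_eq_norm_sq_mul hsb hT (hβ i) hcb
  exact contDiffOn_radialMap hPs hQs hP hQ haP hbQ
    (fun r hr => ⟨hrb.hasDerivAt hsb hr, hrb.deriv_pos hsb hT (hβ i) hr⟩)
    (hrb.strictMonoOn hsb hT (hβ i) hcb)
    fun r hr => ⟨mapsTo_chartRadius hρ i hr, hab i r hr⟩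

theorem radialCoeff_chartRadius {T φ : ℝ} {a b ρ : ℝ → ℝ}
    (hab : ∀ r ∈ Ioo (0 : ℝ) 1, b (ρ r) = a r) (i : Fin 2) :
    ∀ r ∈ Ioo (0 : ℝ) 1, radialCoeff p q T φ b i (chartRadius ρ i r) =
      radialCoeff p q T φ a i r := by
  fin_cases i
  · exact hab
  · intro r hr
    have := hab (1 - r) ⟨by linarith [hr.2], by linarith [hr.1]⟩
    simp [radialCoeff, chartRadius, this]

end LensSpace

/-! ### Construction of the reparametrization. -/

/-- Two strictly increasing continuous functions on `[0, 1]` with the same boundary values differ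
by a reparametrization. -/
theorem exists_reparametrization {a b : ℝ → ℝ} (ha : ContinuousOn a (Icc 0 1))
    (hb : ContinuousOn b (Icc 0 1)) (hma : StrictMonoOn a (Icc 0 1))
    (hmb : StrictMonoOn b (Icc 0 1)) (h0 : a 0 = b 0) (h1 : a 1 = b 1) :
    ∃ ρ σ : ℝ → ℝ, BijOn ρ (Icc 0 1) (Icc 0 1) ∧ StrictMonoOn ρ (Icc 0 1) ∧
      ρ 0 = 0 ∧ ρ 1 = 1 ∧ MapsTo ρ (Ioo 0 1) (Ioo 0 1) ∧ MapsTo σ (Ioo 0 1) (Ioo 0 1) ∧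
      (∀ r ∈ Icc (0 : ℝ) 1, b (ρ r) = a r) ∧ (∀ r ∈ Ioo (0 : ℝ) 1, a (σ r) = b r) ∧
      (∀ r ∈ Ioo (0 : ℝ) 1, σ (ρ r) = r) ∧ (∀ r ∈ Ioo (0 : ℝ) 1, ρ (σ r) = r) := by
  have z0 : (0 : ℝ) ∈ Icc (0 : ℝ) 1 := by simp
  have z1 : (1 : ℝ) ∈ Icc (0 : ℝ) 1 := by simp
  -- solving `b x = a r`
  have key : ∀ {a b : ℝ → ℝ}, ContinuousOn b (Icc 0 1) → StrictMonoOn a (Icc 0 1) →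
      a 0 = b 0 → a 1 = b 1 → ∃ ρ : ℝ → ℝ, ∀ r ∈ Icc (0 : ℝ) 1, ρ r ∈ Icc (0 : ℝ) 1 ∧
        b (ρ r) = a r := by
    intro a b hb hma h0 h1
    -- The membership condition sits inside the existential so that choice yields a function on all
    -- of `ℝ`; its values outside `[0, 1]` are arbitrary.
    have : ∀ r : ℝ, ∃ x, r ∈ Icc (0 : ℝ) 1 → x ∈ Icc (0 : ℝ) 1 ∧ b x = a r := by
      intro r
      by_cases hr : r ∈ Icc (0 : ℝ) 1
      · obtain ⟨x, hx, hxr⟩ := intermediate_value_Icc zero_le_one hb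
          (show a r ∈ Icc (b 0) (b 1) by
            rw [← h0, ← h1]
            exact ⟨hma.monotoneOn z0 hr hr.1, hma.monotoneOn hr z1 hr.2⟩)
        exact ⟨x, fun _ => ⟨hx, hxr⟩⟩
      · exact ⟨0, fun h => absurd h hr⟩
    choose ρ hρ using this
    exact ⟨ρ, hρ⟩
  obtain ⟨ρ, hρ⟩ := key hb hma h0 h1
  obtain ⟨σ, hσ⟩ := key ha hmb h0.symm h1.symm
  have hσρ : ∀ r ∈ Icc (0 : ℝ) 1, σ (ρ r) = r := fun r hr =>
    hma.injOn (hσ _ (hρ r hr).1).1 hr ((hσ _ (hρ r hr).1).2.trans (hρ r hr).2)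
  have hρσ : ∀ r ∈ Icc (0 : ℝ) 1, ρ (σ r) = r := fun r hr =>
    hmb.injOn (hρ _ (hσ r hr).1).1 hr ((hρ _ (hσ r hr).1).2.trans (hσ r hr).2)
  have mono : ∀ {a b ρ : ℝ → ℝ}, StrictMonoOn a (Icc 0 1) → StrictMonoOn b (Icc 0 1) →
      (∀ r ∈ Icc (0 : ℝ) 1, ρ r ∈ Icc (0 : ℝ) 1 ∧ b (ρ r) = a r) → StrictMonoOn ρ (Icc 0 1) := by
    intro a b ρ hma hmb hρ x hx y hy hxy
    rw [← hmb.lt_iff_lt (hρ x hx).1 (hρ y hy).1, (hρ x hx).2, (hρ y hy).2]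
    exact hma hx hy hxy
  have zero : ∀ {a b ρ : ℝ → ℝ}, StrictMonoOn b (Icc 0 1) → a 0 = b 0 →
      (∀ r ∈ Icc (0 : ℝ) 1, ρ r ∈ Icc (0 : ℝ) 1 ∧ b (ρ r) = a r) → ρ 0 = 0 :=
    fun hmb h0 hρ => hmb.injOn (hρ 0 z0).1 z0 ((hρ 0 z0).2.trans h0)
  have one : ∀ {a b ρ : ℝ → ℝ}, StrictMonoOn b (Icc 0 1) → a 1 = b 1 →
      (∀ r ∈ Icc (0 : ℝ) 1, ρ r ∈ Icc (0 : ℝ) 1 ∧ b (ρ r) = a r) → ρ 1 = 1 :=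
    fun hmb h1 hρ => hmb.injOn (hρ 1 z1).1 z1 ((hρ 1 z1).2.trans h1)
  have maps : ∀ {ρ : ℝ → ℝ}, StrictMonoOn ρ (Icc 0 1) → ρ 0 = 0 → ρ 1 = 1 →
      MapsTo ρ (Ioo 0 1) (Ioo 0 1) := by
    intro ρ hm h0 h1 r hr
    have hr' := Ioo_subset_Icc_self hr
    exact ⟨by rw [← h0]; exact hm z0 hr' hr.1, by rw [← h1]; exact hm hr' z1 hr.2⟩
  have mρ := mono hma hmb hρ
  have mσ := mono hmb hma hσ
  exact ⟨ρ, σ, ⟨fun r hr => (hρ r hr).1, mρ.injOn, fun r hr => ⟨σ r, (hσ r hr).1, hρσ r hr⟩⟩, mρ,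
    zero hmb h0 hρ, one hmb h1 hρ, maps mρ (zero hmb h0 hρ) (one hmb h1 hρ),
    maps mσ (zero hma h0.symm hσ) (one hma h1.symm hσ), fun r hr => (hρ r hr).2,
    fun r hr => (hσ r (Ioo_subset_Icc_self hr)).2, fun r hr => hσρ r (Ioo_subset_Icc_self hr),
    fun r hr => hρσ r (Ioo_subset_Icc_self hr)⟩

end

/-! ### The theorem. -/

theorem mainTheorem7 (p q m s : ℤ) (hp : 0 < p) (h : m * p + s * q = 1)
    (τ₀ φ₀ : ℝ) (hτ₀ : 0 < τ₀) (a b : ℝ → ℝ)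
    (ha : ContDiffOn ℝ ∞ a (Icc 0 1)) (hb : ContDiffOn ℝ ∞ b (Icc 0 1))
    (α β : LensSpace.OneForm p q m s h)
    (hα : α.IsPositiveContact) (hβ : β.IsPositiveContact)
    (hαa : α.IsAssociated a τ₀ φ₀) (hβb : β.IsAssociated b τ₀ φ₀) :
    ∃ Ψ : LensSpace p q m s h ≃ₘ^∞⟮𝓘(ℝ, ℂ × ℝ), 𝓘(ℝ, ℂ × ℝ)⟯ LensSpace p q m s h,
      LensSpace.IsPullback Ψ β α ∧
      ∃ ρ : ℝ → ℝ, BijOn ρ (Icc 0 1) (Icc 0 1) ∧ StrictMonoOn ρ (Icc 0 1) ∧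
        (∀ r ∈ Icc (0 : ℝ) 1, b (ρ r) = a r) ∧
        (∀ r ∈ Ico (0 : ℝ) 1, ∀ θ z : ℝ,
          Ψ (LensSpace.psiCoord 0 (r * Complex.exp (θ * Complex.I), z)) =
            LensSpace.psiCoord 0 (ρ r * Complex.exp (θ * Complex.I), z)) ∧
        (∀ r ∈ Ico (0 : ℝ) 1, ∀ θ z : ℝ,
          Ψ (LensSpace.psiCoord 1 (r * Complex.exp (θ * Complex.I), z)) =
            LensSpace.psiCoord 1 ((1 - ρ (1 - r) : ℝ) * Complex.exp (θ * Complex.I), z)) := by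
  have hca := ha.continuousOn
  have hcb := hb.continuousOn
  have hφ := LensSpace.add_mul_pos hp hτ₀ hα hαa hca
  obtain ⟨ρ, σ, hbij, hmono, hρ0, hρ1, hρ, hσ, hab, hba, hσρ, hρσ⟩ :=
    exists_reparametrization hca hcb (LensSpace.coeff_strictMonoOn hτ₀ hα hαa hca)
      (LensSpace.coeff_strictMonoOn hτ₀ hβ hβb hcb)
      ((LensSpace.coeff_zero hαa hca).trans (LensSpace.coeff_zero hβb hcb).symm)
      -- Both `a 1` and `b 1` solve the same linear equation with nonzero leading coefficient `q +
      -- pφ₀`.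
      (mul_left_cancel₀ hφ.ne'
        ((LensSpace.coeff_one hαa hca).trans (LensSpace.coeff_one hβb hcb).symm))
  have hab' := LensSpace.radialCoeff_chartRadius (p := p) (q := q) (T := τ₀ / (2 * Real.pi))
    (φ := φ₀) fun r hr => hab r (Ioo_subset_Icc_self hr)
  have hba' := LensSpace.radialCoeff_chartRadius (p := p) (q := q) (T := τ₀ / (2 * Real.pi))
    (φ := φ₀) hba
  have hsρ := LensSpace.contDiffOn_radialMap_chartRadius hτ₀ hφ hca hcb hα hβ hαa hβb hρ hab'
  -- The inverse is smooth by the same lemma with `α` and `β` exchanged, since `a ∘ σ = b`.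
  have hsσ := LensSpace.contDiffOn_radialMap_chartRadius hτ₀ hφ hcb hca hβ hα hβb hαa hσ hba'
  -- The constants are chosen before the form, so `α` and `β` share them in each chart.
  choose T φ hT hrad using LensSpace.exists_isRadialForm_coord h hτ₀ hφ
  have hnorm : ∀ r ∈ Ico (0 : ℝ) 1, ∀ θ : ℝ, ‖(r : ℂ) * Complex.exp (θ * Complex.I)‖ < 1 := by
    intro r hr θ
    rw [norm_mul, Complex.norm_exp_ofReal_mul_I, mul_one, Complex.norm_real,
      Real.norm_of_nonneg hr.1]
    exact hr.2
  refine ⟨{ toFun := LensSpace.radialReparam ρ hρ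
            invFun := LensSpace.radialReparam σ hσ
            left_inv := LensSpace.radialReparam_radialReparam hρ hσ hσρ
            right_inv := LensSpace.radialReparam_radialReparam hσ hρ hρσ
            contMDiff_toFun := LensSpace.contMDiff_radialReparam hρ hsρ
            contMDiff_invFun := LensSpace.contMDiff_radialReparam hσ hsσ },
    LensSpace.isPullback_radialReparam (fun i => hrad i α a hαa) (fun i => hrad i β b hβb) hρ
      hab' hsρ, ρ, hbij, hmono, hab, fun r hr θ z => ?_, fun r hr θ z => ?_⟩
  · refine (LensSpace.radialReparam_psiCoord hρ 0 (hnorm r hr θ)).trans ?_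
    congr 2
    exact radialMap_mul_exp hr.1 hρ0 θ
  · refine (LensSpace.radialReparam_psiCoord hρ 1 (hnorm r hr θ)).trans ?_
    congr 2
    exact radialMap_mul_exp hr.1 (by simp [LensSpace.chartRadius, hρ1]) θ
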